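/- **Notation.** For $a>0$, a real function $f$ on $[a,\infty)$ and $\lambda\ge 1$ put $$\overline{\nu}(f;\lambda):=-\inf\{f(y)-f(x): a\le x\le y\le\lambda x\},\qquad \nu(f;\lambda):=-\liminf_{x\to\infty}\ \inf_{x\le y\le\lambda x}\{f(y)-f(x)\}.$$ $f$ is *slowly decreasing* if $\lim_{\lambda\downarrow1}\nu(f;\lambda)=0$. We write $u_+=\max(u,0)$ and $\|A\|_{I}=\sup_{x\in I}|A(x)|$. **Theorem.** Let $A:\mathbb R\to\mathbb R$ be of locally bounded variation, vanishing on $(-\infty,1)$, such that the Mellin–Stieltjes transform $\mathcal A(s)=\int_{1^-}^\infty x^{-s}\,dA(x)$ (an improper Riemann–Stieltjes integral, including the jump $A(1)$ at $1$) converges for $\Re s>1$. Let $n\ge 0$ and $m_0,\dots,m_n\ge1$ be integers, $c_{k,l}\in\mathbb C$, $\omega_{k,l}>-1$ real ($0\le k\le n$, $1\le l\le m_k$), $b_0=0$ and $b_k>0$ real for $1\le k\le n$. For $\Re s>0$, $\sigma>0$, $T>0$ put $$G(s)=\frac{\mathcal A(s+1)}{s+1}-\sum_{k=0}^{n}\sum_{l=1}^{m_k}\left(\frac{c_{k,l}}{(s+ib_k)^{\omega_{k,l}+1}}+\frac{\overline{c_{k,l}}}{(s-ib_k)^{\omega_{k,l}+1}}\right),\qquad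 \eta(\sigma,T)=\int_{-T}^{T}|G(2\sigma+i\tau)-G(\sigma+i\tau)|\,d\tau,$$ with principal branches of the powers, and let $\Omega=\max_{k,l}\omega_{k,l}$, $\omega=\min_{k,l}\omega_{k,l}$. Assume that $A(x)/x$ is slowly decreasing on $[1,\infty)$. Fix $T>0$ and assume that for some constant $K$ $$\eta(\sigma,T)\le K\sigma^{-\Omega_+}\qquad(0<\sigma<1).$$ Let $\Psi=\Psi_{e^{1/T}}$ be any nonincreasing function on $[1,\infty)$ with $\lim_{x\to\infty}\Psi(x)=0$ such that, with $f(x)=A(x)/x$ on $[1,\infty)$ and $\lambda=e^{1/T}$, $$f(y)-f(x)\ \ge\ -\nu(f;\lambda)-\Psi(x)\ \ge\ -\overline{\nu}(f;\lambda)\qquad\text{whenever } 1\le x\le y\le\lambda x.$$ Then for all $x\ge\max(e,e^{17/T},e^{17/\sqrt T})$ $$\left|A(x)-x\sum_{k=0}^{n}\sum_{l=1}^{m_k}\frac{(\log x)^{\omega_{k,l}}}{\Gamma(\omega_{k,l}+1)}\,2\Re\left(c_{k,l}e^{-ib_k\log x}\right)\right|\le C\,x\,\rho_T(x),$$ where $$\rho_T(x)=\sqrt{\Psi(1)\Psi(\sqrt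 x)}+R_T(x)+\sqrt{\Psi(1)R_T(x)},$$ $$R_T(x)=\nu\!\left(\frac{A(x)}{x};e^{1/T}\right)+\left(1+\frac1T\right)\eta\!\left(\frac1{\log x},T\right)+\frac{\log^{\Omega_+}x+\log\log x}{T}+\frac1{T^{\omega+1}\log x}+\frac1{T^{\Omega+1}\log x},$$ and the constant $C>0$ depends only on $\overline{\nu}(A(x)/x;e)$, $\|A\|_{[1,e]}$, $\mathcal A(2)$, $K$, and the families $(c_{k,l})$ and $(b_k)$ (with their index ranges $n$, $m_k$). -/

import Mathlib

open Filter Topology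

noncomputable section

namespace WienerIkehara

/-! ### The Mellin-Stieltjes transform -/

/-- `I` is the Riemann-Stieltjes integral of `f` with respect to `A` over `[a, b]`: the sums
`∑ f(ξ_i) (A(p_{i+1}) - A(p_i))` over tagged partitions `a = p_0 ≤ ξ_0 ≤ p_1 ≤ ⋯ ≤ p_N = b`
converge to `I` as the mesh tends to zero. -/
def HasStieltjesIntegral (f : ℝ → ℂ) (A : ℝ → ℝ) (a b : ℝ) (I : ℂ) : Prop :=
  ∀ ε : ℝ, 0 < ε → ∃ δ : ℝ, 0 < δ ∧ ∀ (N : ℕ) (p ξ : ℕ → ℝ), p 0 = a → p N = b →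
    (∀ i < N, p i ≤ ξ i ∧ ξ i ≤ p (i + 1) ∧ p (i + 1) - p i < δ) →
    ‖(∑ i ∈ Finset.range N, f (ξ i) * ((A (p (i + 1)) - A (p i) : ℝ) : ℂ)) - I‖ < ε

/-- The improper integral `∫_{1⁻}^∞ x^{-s} dA(x) = lim_{X → ∞} ∫_{1⁻}^X x^{-s} dA(x)` converges to
`w`. For a function `A` that vanishes on `(-∞, 1)`, the jump at `1` contributes
`1^{-s} A(1) = A(1)`. -/
def HasMellinStieltjes (A : ℝ → ℝ) (s w : ℂ) : Prop :=
  ∃ I : ℝ → ℂ, (∀ X : ℝ, 1 ≤ X → HasStieltjesIntegral (fun x => (x : ℂ) ^ (-s)) A 1 X (I X)) ∧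
    Tendsto (fun X => (A 1 : ℂ) + I X) atTop (𝓝 w)

/-- The integral `∫_{1⁻}^∞ x^{-s} dA(x)` converges. -/
def MellinStieltjesConverges (A : ℝ → ℝ) (s : ℂ) : Prop :=
  ∃ w : ℂ, HasMellinStieltjes A s w

open Classical in
/-- The Mellin-Stieltjes transform of `A` (with value `0` where the integral diverges). -/
def mellinStieltjes (A : ℝ → ℝ) (s : ℂ) : ℂ :=
  if h : MellinStieltjesConverges A s then h.choose else 0

/-! ### Controlled decrease -/

/-- The largest decrease of `f` on `[x, λ x]` from its value at `x`:
`-inf {f(y) - f(x) : x ≤ y ≤ λ x}`. -/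
def localDecrease (f : ℝ → ℝ) (lam x : ℝ) : EReal :=
  ⨆ y ∈ Set.Icc x (lam * x), ((f x - f y : ℝ) : EReal)

/-- `ν̄(f; λ) = -inf {f(y) - f(x) : a ≤ x ≤ y ≤ λ x}`. -/
def nuBar (f : ℝ → ℝ) (a lam : ℝ) : EReal :=
  ⨆ x ∈ Set.Ici a, localDecrease f lam x

/-- `ν(f; λ) = -liminf_{x → ∞} inf {f(y) - f(x) : x ≤ y ≤ λ x}`. -/
def nu (f : ℝ → ℝ) (lam : ℝ) : EReal :=
  limsup (localDecrease f lam) atTop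

/-- Slowly decreasing functions in the sense of Schmidt: `ν(f; λ) → 0` as `λ ↓ 1`. -/
def IsSlowlyDecreasing (f : ℝ → ℝ) : Prop :=
  Tendsto (nu f) (𝓝[>] 1) (𝓝 0)

/-- `Ψ` is a nonincreasing function on `[a, ∞)` that tends to `0` at infinity, such that
`f(y) - f(x) ≥ -ν(f; λ) - Ψ(x) ≥ -ν̄(f; λ)` whenever `a ≤ x ≤ y ≤ λ x`. -/
structure IsDecreaseRemainder (f : ℝ → ℝ) (a lam : ℝ) (Ψ : ℝ → ℝ) : Prop where
  antitone : AntitoneOn Ψ (Set.Ici a)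
  tendsto_zero : Tendsto Ψ atTop (𝓝 0)
  lower : ∀ x y : ℝ, a ≤ x → x ≤ y → y ≤ lam * x →
    -nu f lam - (Ψ x : EReal) ≤ ((f y - f x : ℝ) : EReal)
  upper : ∀ x : ℝ, a ≤ x → -nuBar f a lam ≤ -nu f lam - (Ψ x : EReal)

/-- `‖A‖_I = sup_{x ∈ I} |A(x)|`. -/
def supNormOn (A : ℝ → ℝ) (I : Set ℝ) : ℝ :=
  sSup ((fun x => |A x|) '' I)

/-! ### The regularized transform and its `η`-function

The index `k` runs over `0, …, n`, and for each `k` the index `l` runs over `m k` values. -/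

section Singular

variable {n : ℕ} {m : Fin (n + 1) → ℕ} (c : (k : Fin (n + 1)) → Fin (m k) → ℂ)
  (b : Fin (n + 1) → ℝ) (w : (k : Fin (n + 1)) → Fin (m k) → ℝ)

/-- `∑_{k,l} (c_{k,l} / (s + i b_k)^{ω_{k,l}+1} + conj c_{k,l} / (s - i b_k)^{ω_{k,l}+1})`, with
principal powers. -/
def singularPart (s : ℂ) : ℂ :=
  ∑ k, ∑ l, (c k l / (s + Complex.I * (b k : ℂ)) ^ ((w k l : ℂ) + 1) +
    (starRingEnd ℂ) (c k l) / (s - Complex.I * (b k : ℂ)) ^ ((w k l : ℂ) + 1))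

/-- `G(s) = 𝒜(s+1)/(s+1) - (singular part)`. -/
def regTransform (A : ℝ → ℝ) (s : ℂ) : ℂ :=
  1 / (s + 1) * mellinStieltjes A (s + 1) - singularPart c b w s

/-- `η(σ, T) = ∫_{-T}^{T} |G(2σ + iτ) - G(σ + iτ)| dτ`. -/
def eta (A : ℝ → ℝ) (σ T : ℝ) : ℝ :=
  ∫ τ in (-T)..T, ‖regTransform c b w A (2 * (σ : ℂ) + Complex.I * (τ : ℂ)) -
    regTransform c b w A ((σ : ℂ) + Complex.I * (τ : ℂ))‖

/-- `Ω = max_{k,l} ω_{k,l}` (a maximum over a finite set). -/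
def maxExponent : ℝ := ⨆ q : (Σ k, Fin (m k)), w q.1 q.2

/-- `ω = min_{k,l} ω_{k,l}` (a minimum over a finite set). -/
def minExponent : ℝ := ⨅ q : (Σ k, Fin (m k)), w q.1 q.2

/-- `∑_{k,l} (log x)^{ω_{k,l}} / Γ(ω_{k,l}+1) · 2 Re (c_{k,l} e^{-i b_k log x})`. -/
def mainTerm (x : ℝ) : ℝ :=
  ∑ k, ∑ l, Real.log x ^ (w k l) / Real.Gamma (w k l + 1) *
    (2 * (c k l * Complex.exp (-(Complex.I * (b k : ℂ) * (Real.log x : ℂ)))).re)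

/-- The quantity `R_T(x)`. -/
def errorR (A : ℝ → ℝ) (T x : ℝ) : ℝ :=
  (nu (fun t => A t / t) (Real.exp (1 / T))).toReal
    + (1 + 1 / T) * eta c b w A (1 / Real.log x) T
    + (Real.log x ^ (max (maxExponent w) 0) + Real.log (Real.log x)) / T
    + 1 / (T ^ (minExponent w + 1) * Real.log x)
    + 1 / (T ^ (maxExponent w + 1) * Real.log x)

/-- The error function `ρ_T(x)`, for a given choice of `Ψ = Ψ_{e^{1/T}}`. -/
def errorRho (A Ψ : ℝ → ℝ) (T x : ℝ) : ℝ :=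
  Real.sqrt (Ψ 1 * Ψ (Real.sqrt x)) + errorR c b w A T x
    + Real.sqrt (Ψ 1 * errorR c b w A T x)

end Singular

end WienerIkehara

end

noncomputable section

namespace WienerIkehara

open MeasureTheory Set

/-! On the logarithmic scale put h(t) = A(e^t)/e^t, let H be the main term, and let X = log x.
Partial integration turns 𝒜(s+1)/(s+1) into the Laplace transform of h, and the singular part is the
Laplace transform of H, so G is the Laplace transform of h - H. Hence u(t) = (e^{-t/X} -
e^{-2t/X})(h(t) - H(t)) on t > 0 has Fourier transform G(1/X + iφ) - G(2/X + iφ), and η(1/X, T) is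
the L¹ norm of that transform on [-T, T]. Everything happens strictly inside the half-plane; no
boundary values of G occur. At t = X the weight is at least 1/8, so a bound for u(X) is a bound for
h(X) - H(X).

The kernel sinc(z/4)^4 is nonnegative with Fourier transform supported in [-1, 1], so all kernel
means of z ↦ u(z/T) are at most 2η (`abs_integral_jacksonKernel_mul_le`). To pass from means to
values, let P be the best constant in |u(z/T)| ≤ P w(z) for a positive weight w. Controlled decrease
of h and slow variation of H make u stay above half of a large value on a window to its right, and
below half of a large negative value on a window to its left. A kernel centred in such a window sees
half the value on its core and at worst P w on its tail, which carries at most a quarter of the core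
mass; therefore P ≤ P/2 + const (`abs_le_weight_of_kernel_means`). Boundedness of u enters only to
make P finite.

The sharp decrease bound δ₁ = ν + Ψ(√x) is available only for t ≥ X/2, and a coarser δ₀ = ν + Ψ(1)
before that. The weight w is therefore a small constant plus a parabola centred at TX: large where
only δ₀ is known, small at the point of interest. If TX is bounded the window argument has no room,
but then X is O(1/T), crude bounds suffice from below and one kernel mean from above
(`abs_sub_le_of_bounded`).

The outcome (`exists_tauberian_constant`) is |h(X) - H(X)| ≤ C(η + δ₁ + X^{Ω₊}/T), which is
dominated by ρ_T. The constant does not depend on the exponents ω because t^ω/Γ(ω+1) is estimated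
uniformly in ω > -1. -/

/-! ### Fourier transforms and means against the Jackson kernel -/

/-- The Fourier transform `θ ↦ ∫ e^{-iθz} u(z) dz`. -/
def fourierInt (u : ℝ → ℂ) (θ : ℝ) : ℂ :=
  ∫ z : ℝ, Complex.exp (-(Complex.I * θ * z)) * u z

lemma norm_exp_neg_I_mul (θ z : ℝ) : ‖Complex.exp (-(Complex.I * θ * z))‖ = 1 := by
  have : -(Complex.I * θ * z) = ((-(θ * z) : ℝ) : ℂ) * Complex.I := by push_cast; ring
  rw [this, Complex.norm_exp_ofReal_mul_I]

lemma norm_exp_I_mul (θ z : ℝ) : ‖Complex.exp (Complex.I * θ * z)‖ = 1 := by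
  have : Complex.I * θ * z = ((θ * z : ℝ) : ℂ) * Complex.I := by push_cast; ring
  rw [this, Complex.norm_exp_ofReal_mul_I]

lemma continuous_fourierInt {u : ℝ → ℂ} (hu : Integrable u) : Continuous (fourierInt u) := by
  refine continuous_of_dominated (bound := fun z => ‖u z‖) ?_ ?_ hu.norm ?_
  · intro θ
    exact (Continuous.aestronglyMeasurable (by fun_prop)).mul hu.1
  · intro θ
    filter_upwards with z
    rw [norm_mul, norm_exp_neg_I_mul, one_mul]
  · filter_upwards with z
    fun_prop

/-- A sinc factor is a normalized average of characters with frequencies in [-1/4, 1/4].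
Multiplication by it averages the Fourier transform over a window of length 1/2, and four factors
reach frequencies up to 1. -/
lemma sinc_eq_integral (z : ℝ) :
    ((Real.sinc (z / 4) : ℝ) : ℂ) =
      2 * ∫ θ in (-(1 / 4 : ℝ))..(1 / 4), Complex.exp (Complex.I * θ * z) := by
  rcases eq_or_ne z 0 with rfl | hz
  · simp; norm_num
  · have hz' : (z : ℂ) ≠ 0 := by exact_mod_cast hz
    have hc : Complex.I * z ≠ 0 := mul_ne_zero Complex.I_ne_zero hz'
    have h1 : ∀ θ : ℝ, Complex.exp (Complex.I * θ * z) = Complex.exp (Complex.I * z * θ) := by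
      intro θ; congr 1; ring
    simp_rw [h1]
    rw [integral_exp_mul_complex hc, Real.sinc_of_ne_zero (by positivity)]
    have h2 : Complex.I * z * ((1 / 4 : ℝ) : ℂ) = (z / 4 : ℂ) * Complex.I := by push_cast; ring
    have h3 : Complex.I * z * ((-(1 / 4) : ℝ) : ℂ) = -(z / 4 : ℂ) * Complex.I := by
      push_cast; ring
    rw [h2, h3]
    push_cast
    rw [Complex.sin]
    have hI := Complex.I_sq
    field_simp
    linear_combination (4 * Complex.exp (-(z * Complex.I / 4)) - 4 * Complex.exp (z * Complex.I / 4)) * hI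

lemma continuous_sinc_shift (y : ℝ) : Continuous fun z : ℝ => Real.sinc ((y - z) / 4) :=
  Real.continuous_sinc.comp (by fun_prop)

lemma integrable_sinc_mul {u : ℝ → ℂ} (hu : Integrable u) (y : ℝ) :
    Integrable fun z : ℝ => ((Real.sinc ((y - z) / 4) : ℝ) : ℂ) * u z := by
  refine hu.bdd_mul (c := 1)
    (Complex.continuous_ofReal.comp (continuous_sinc_shift y)).aestronglyMeasurable ?_
  filter_upwards with z
  rw [Complex.norm_real, Real.norm_eq_abs]
  exact Real.abs_sinc_le_one _

lemma fourierInt_sinc_mul {u : ℝ → ℂ} (hu : Integrable u) (y θ : ℝ) :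
    fourierInt (fun z => ((Real.sinc ((y - z) / 4) : ℝ) : ℂ) * u z) θ =
      2 * ∫ φ in (-(1 / 4 : ℝ))..(1 / 4),
        Complex.exp (Complex.I * φ * y) * fourierInt u (θ + φ) := by
  unfold fourierInt
  have h1 : ∀ z : ℝ, Complex.exp (-(Complex.I * θ * z)) *
      (((Real.sinc ((y - z) / 4) : ℝ) : ℂ) * u z) =
      ∫ φ in Ioc (-(1 / 4 : ℝ)) (1 / 4), 2 * (Complex.exp (Complex.I * φ * y) *
        (Complex.exp (-(Complex.I * (θ + φ : ℝ) * z)) * u z)) := by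
    intro z
    rw [sinc_eq_integral, intervalIntegral.integral_of_le (by norm_num)]
    rw [← integral_const_mul, ← integral_mul_const, ← integral_const_mul]
    refine integral_congr_ae ?_
    filter_upwards with φ
    have : Complex.exp (Complex.I * φ * ((y - z : ℝ) : ℂ)) * Complex.exp (-(Complex.I * θ * z)) =
        Complex.exp (Complex.I * φ * y) * Complex.exp (-(Complex.I * (θ + φ : ℝ) * z)) := by
      rw [← Complex.exp_add, ← Complex.exp_add]; congr 1; push_cast; ring
    linear_combination 2 * u z * this
  simp_rw [h1]
  rw [integral_integral_swap]
  · rw [intervalIntegral.integral_of_le (by norm_num), ← integral_const_mul]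
    refine integral_congr_ae ?_
    filter_upwards with φ
    rw [integral_const_mul, integral_const_mul]
  · have hv : Integrable (fun p : ℝ × ℝ => u p.1 * (1 : ℂ))
        ((volume : Measure ℝ).prod (volume.restrict (Ioc (-(1 / 4 : ℝ)) (1 / 4)))) :=
      hu.mul_prod (integrable_const (1 : ℂ))
    have hb := hv.bdd_mul (c := 2) (f := fun p : ℝ × ℝ =>
      2 * (Complex.exp (Complex.I * p.2 * y) * Complex.exp (-(Complex.I * (θ + p.2 : ℝ) * p.1))))
      (Continuous.aestronglyMeasurable (by fun_prop)) (by
        filter_upwards with p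
        rw [norm_mul, norm_mul, norm_exp_I_mul, norm_exp_neg_I_mul]; simp)
    refine hb.congr ?_
    filter_upwards with p
    simp only [Function.uncurry]
    ring

/-- The first factor converts an L¹ bound on the transform into a pointwise bound. -/
lemma norm_fourierInt_sinc_mul_le {u : ℝ → ℂ} (hu : Integrable u) (y θ : ℝ) :
    ‖fourierInt (fun z => ((Real.sinc ((y - z) / 4) : ℝ) : ℂ) * u z) θ‖ ≤
      2 * ∫ φ in (θ - 1 / 4)..(θ + 1 / 4), ‖fourierInt u φ‖ := by
  rw [fourierInt_sinc_mul hu, norm_mul, Complex.norm_two]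
  refine mul_le_mul_of_nonneg_left ?_ (by norm_num)
  refine (intervalIntegral.norm_integral_le_integral_norm (by norm_num)).trans (le_of_eq ?_)
  have := intervalIntegral.integral_comp_add_left (a := -(1 / 4 : ℝ)) (b := 1 / 4)
    (fun φ => ‖fourierInt u φ‖) θ
  rw [← sub_eq_add_neg] at this
  rw [← this]
  refine intervalIntegral.integral_congr fun φ _ => ?_
  simp only [norm_mul, norm_exp_I_mul, one_mul]

/-- Each later factor preserves a sup bound, since the average has total weight one, at the price of
shrinking the interval by 1/4 on each side. -/
lemma norm_fourierInt_sinc_mul_le_of_le {u : ℝ → ℂ} (hu : Integrable u) {y θ r B : ℝ}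
    (hB : ∀ φ, |φ| ≤ r + 1 / 4 → ‖fourierInt u φ‖ ≤ B) (hθ : |θ| ≤ r) :
    ‖fourierInt (fun z => ((Real.sinc ((y - z) / 4) : ℝ) : ℂ) * u z) θ‖ ≤ B := by
  refine (norm_fourierInt_sinc_mul_le hu y θ).trans ?_
  have h : ∫ φ in (θ - 1 / 4)..(θ + 1 / 4), ‖fourierInt u φ‖ ≤
      ∫ φ in (θ - 1 / 4)..(θ + 1 / 4), B := by
    refine intervalIntegral.integral_mono_on (by linarith)
      ((continuous_fourierInt hu).norm.intervalIntegrable _ _) (by simp) fun φ hφ => hB φ ?_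
    rw [abs_le] at hθ ⊢
    exact ⟨by linarith [hφ.1], by linarith [hφ.2]⟩
  rw [intervalIntegral.integral_const, smul_eq_mul] at h
  linarith

/-- The Jackson kernel, a nonnegative kernel whose Fourier transform is supported in `[-1, 1]`. -/
def jacksonKernel (z : ℝ) : ℝ := Real.sinc (z / 4) ^ 4

lemma jacksonKernel_nonneg (z : ℝ) : 0 ≤ jacksonKernel z := by
  unfold jacksonKernel; positivity

lemma continuous_jacksonKernel : Continuous jacksonKernel :=
  (Real.continuous_sinc.comp (by fun_prop)).pow 4

lemma jacksonKernel_le_one (z : ℝ) : jacksonKernel z ≤ 1 := by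
  unfold jacksonKernel
  rw [← Even.pow_abs (by decide : Even 4)]
  exact pow_le_one₀ (abs_nonneg _) (Real.abs_sinc_le_one _)

lemma pow_four_mul_jacksonKernel_le (z : ℝ) : z ^ 4 * jacksonKernel z ≤ 256 := by
  rcases eq_or_ne z 0 with rfl | hz
  · simp
  · unfold jacksonKernel
    rw [Real.sinc_of_ne_zero (by positivity)]
    have h : Real.sin (z / 4) ^ 4 ≤ 1 := by
      rw [← Even.pow_abs (by decide : Even 4)]
      exact pow_le_one₀ (abs_nonneg _) (Real.abs_sin_le_one _)
    have : z ^ 4 * (Real.sin (z / 4) / (z / 4)) ^ 4 = 256 * Real.sin (z / 4) ^ 4 := by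
      field_simp; ring
    rw [this]; linarith

/-- The kernel mean is the value at frequency 0 of the transform of u multiplied by four sinc
factors, so only frequencies in [-1, 1] contribute. -/
lemma abs_integral_jacksonKernel_mul_le {u : ℝ → ℝ} (hu : Integrable u) (y : ℝ) :
    |∫ z, jacksonKernel (y - z) * u z| ≤
      2 * ∫ φ in (-1 : ℝ)..1, ‖fourierInt (fun z => (u z : ℂ)) φ‖ := by
  set B := 2 * ∫ φ in (-1 : ℝ)..1, ‖fourierInt (fun z => (u z : ℂ)) φ‖
  have hu0 : Integrable fun z => (u z : ℂ) := hu.ofReal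
  have hu1 := integrable_sinc_mul hu0 y
  have hu2 := integrable_sinc_mul hu1 y
  have hu3 := integrable_sinc_mul hu2 y
  -- The radii of validity run 3/4, 1/2, 1/4, 0 over the four factors.
  have b1 : ∀ φ, |φ| ≤ 1 / 2 + 1 / 4 → ‖fourierInt (fun z =>
      ((Real.sinc ((y - z) / 4) : ℝ) : ℂ) * (u z : ℂ)) φ‖ ≤ B := by
    intro φ hφ
    refine (norm_fourierInt_sinc_mul_le hu0 y φ).trans ?_
    refine mul_le_mul_of_nonneg_left ?_ (by norm_num)
    rw [abs_le] at hφ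
    refine intervalIntegral.integral_mono_interval (by linarith) (by linarith) (by linarith) ?_
      ((continuous_fourierInt hu0).norm.intervalIntegrable _ _)
    filter_upwards with z using norm_nonneg _
  have b2 := fun φ (h : |φ| ≤ 1 / 4 + 1 / 4) =>
    norm_fourierInt_sinc_mul_le_of_le hu1 (y := y) (r := 1 / 2) b1 (h.trans (by norm_num))
  have b3 := fun φ (h : |φ| ≤ 0 + 1 / 4) =>
    norm_fourierInt_sinc_mul_le_of_le hu2 (y := y) (r := 1 / 4) b2 (h.trans (by norm_num))
  have b4 := norm_fourierInt_sinc_mul_le_of_le hu3 (y := y) (r := 0) b3 (θ := 0) (by simp)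
  have key : fourierInt (fun z => ((Real.sinc ((y - z) / 4) : ℝ) : ℂ) *
      (((Real.sinc ((y - z) / 4) : ℝ) : ℂ) * (((Real.sinc ((y - z) / 4) : ℝ) : ℂ) *
      (((Real.sinc ((y - z) / 4) : ℝ) : ℂ) * (u z : ℂ))))) 0 =
      ((∫ z, jacksonKernel (y - z) * u z : ℝ) : ℂ) := by
    rw [← integral_complex_ofReal]
    unfold fourierInt jacksonKernel
    refine integral_congr_ae ?_
    filter_upwards with z
    simp only [Complex.ofReal_zero, mul_zero, zero_mul, neg_zero, Complex.exp_zero, one_mul]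
    push_cast
    ring
  rw [key, Complex.norm_real, Real.norm_eq_abs] at b4
  exact b4

/-! ### Mass and weighted tail of the kernel -/

lemma integrable_jacksonKernel_mul_quadratic :
    Integrable fun z => jacksonKernel z * (2 + 8 * z ^ 2) := by
  have h := (integrable_inv_one_add_sq).const_mul 3000
  refine h.mono' (continuous_jacksonKernel.mul (by fun_prop)).aestronglyMeasurable ?_
  filter_upwards with z
  have h0 := jacksonKernel_nonneg z
  have h1 := jacksonKernel_le_one z
  have h4 := pow_four_mul_jacksonKernel_le z
  rw [Real.norm_of_nonneg (by positivity), ← div_eq_mul_inv, le_div_iff₀ (by positivity)]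
  have h2 : z ^ 2 * jacksonKernel z ≤ 1 + 256 := by
    nlinarith [mul_nonneg (sq_nonneg (z ^ 2 - 1)) h0]
  nlinarith

lemma integrable_jacksonKernel : Integrable jacksonKernel := by
  refine integrable_jacksonKernel_mul_quadratic.mono'
    continuous_jacksonKernel.aestronglyMeasurable ?_
  filter_upwards with z
  have h0 := jacksonKernel_nonneg z
  rw [Real.norm_of_nonneg h0]
  nlinarith [mul_nonneg h0 (sq_nonneg z)]

/-- The mass of the Jackson kernel on `[-r, r]`. -/
def kernelMass (r : ℝ) : ℝ := ∫ z, (Icc (-r) r).indicator jacksonKernel z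

/-- The weighted tail of the Jackson kernel outside `[-r, r]`. -/
def kernelTail (r : ℝ) : ℝ :=
  ∫ z, (Icc (-r) r)ᶜ.indicator (fun z => jacksonKernel z * (2 + 8 * z ^ 2)) z

lemma kernelTail_nonneg (r : ℝ) : 0 ≤ kernelTail r := by
  refine integral_nonneg fun z => indicator_nonneg (fun z _ => ?_) z
  have := jacksonKernel_nonneg z
  positivity

lemma kernelMass_mono {r s : ℝ} (h : r ≤ s) : kernelMass r ≤ kernelMass s := by
  refine integral_mono (integrable_jacksonKernel.indicator measurableSet_Icc)
    (integrable_jacksonKernel.indicator measurableSet_Icc) fun z => ?_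
  exact indicator_le_indicator_of_subset (Icc_subset_Icc (by linarith) h) jacksonKernel_nonneg z

lemma kernelMass_pos {r : ℝ} (hr : 0 < r) : 0 < kernelMass r := by
  unfold kernelMass
  rw [integral_indicator measurableSet_Icc, integral_Icc_eq_integral_Ioc,
    ← intervalIntegral.integral_of_le (by linarith)]
  refine intervalIntegral.integral_pos (by linarith) continuous_jacksonKernel.continuousOn
    (fun z _ => jacksonKernel_nonneg z) ⟨0, ⟨by linarith, hr.le⟩, ?_⟩
  simp [jacksonKernel]

lemma tendsto_kernelTail : Tendsto (fun k : ℕ => kernelTail k) atTop (𝓝 0) := by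
  have : (0 : ℝ) = ∫ _ : ℝ, (0 : ℝ) := by simp
  rw [this]
  refine tendsto_integral_of_dominated_convergence
    (fun z => jacksonKernel z * (2 + 8 * z ^ 2)) ?_ integrable_jacksonKernel_mul_quadratic ?_ ?_
  · intro k
    exact (integrable_jacksonKernel_mul_quadratic.indicator measurableSet_Icc.compl).1
  · intro k
    filter_upwards with z
    have h0 := jacksonKernel_nonneg z
    refine (norm_indicator_le_norm_self _ z).trans (le_of_eq (Real.norm_of_nonneg (by positivity)))
  · filter_upwards with z
    refine tendsto_const_nhds.congr' ?_
    filter_upwards [eventually_ge_atTop ⌈|z|⌉₊] with k hk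
    have : |z| ≤ k := (Nat.le_ceil _).trans (by exact_mod_cast hk)
    rw [indicator_of_notMem]
    simpa [abs_le] using this

/-- The factor 1/4 is half of the 1/2 retained on the core; dividing the resulting inequality by
that 1/2 leaves P/2 in the self-improvement step. -/
lemma exists_kernelTail_le : ∃ r : ℝ, 1 ≤ r ∧ kernelTail r ≤ kernelMass r / 4 := by
  have h := tendsto_kernelTail.eventually (ge_mem_nhds (div_pos (kernelMass_pos one_pos) four_pos))
  obtain ⟨k, hk, hk1⟩ := (h.and (eventually_ge_atTop 1)).exists
  have hk1' : (1 : ℝ) ≤ k := by exact_mod_cast hk1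
  exact ⟨k, hk1', hk.trans (div_le_div_of_nonneg_right (kernelMass_mono hk1') (by norm_num))⟩

lemma integrable_jacksonKernel_shift_mul {u : ℝ → ℝ} (hu : Integrable u) (y : ℝ) :
    Integrable fun s => jacksonKernel (y - s) * u s := by
  refine hu.bdd_mul (c := 1)
    (continuous_jacksonKernel.comp (by fun_prop)).aestronglyMeasurable ?_
  filter_upwards with z
  rw [Real.norm_of_nonneg (jacksonKernel_nonneg _)]
  exact jacksonKernel_le_one _

/-! ### From kernel means to pointwise bounds by self-improvement -/

/-- Lower bound for a kernel mean of a function bounded below near and away from the centre. -/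
lemma le_integral_jacksonKernel_mul {u : ℝ → ℝ} (hu : Integrable u) {y r β q : ℝ}
    (h1 : ∀ s, |s - y| ≤ r → β ≤ u s)
    (h2 : ∀ s, r < |s - y| → -(q * (2 + 8 * (s - y) ^ 2)) ≤ u s) :
    β * kernelMass r - q * kernelTail r ≤ ∫ s, jacksonKernel (y - s) * u s := by
  set k₁ : ℝ → ℝ := (Icc (-r) r).indicator jacksonKernel
  set k₂ : ℝ → ℝ := (Icc (-r) r)ᶜ.indicator (fun z => jacksonKernel z * (2 + 8 * z ^ 2))
  have i1 : Integrable k₁ := integrable_jacksonKernel.indicator measurableSet_Icc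
  have i2 : Integrable k₂ :=
    integrable_jacksonKernel_mul_quadratic.indicator measurableSet_Icc.compl
  have e1 : kernelMass r = ∫ s, k₁ (y - s) := (integral_sub_left_eq_self k₁ volume y).symm
  have e2 : kernelTail r = ∫ s, k₂ (y - s) := (integral_sub_left_eq_self k₂ volume y).symm
  have j1 : Integrable fun s => k₁ (y - s) := i1.comp_sub_left y
  have j2 : Integrable fun s => k₂ (y - s) := i2.comp_sub_left y
  rw [e1, e2, ← integral_const_mul, ← integral_const_mul,
    ← integral_sub (j1.const_mul _) (j2.const_mul _)]
  refine integral_mono ((j1.const_mul _).sub (j2.const_mul _))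
    (integrable_jacksonKernel_shift_mul hu y) fun s => ?_
  have h0 := jacksonKernel_nonneg (y - s)
  rcases le_or_gt |s - y| r with h | h
  · have hm : y - s ∈ Icc (-r) r := by
      rw [abs_le] at h; exact ⟨by linarith [h.2], by linarith [h.1]⟩
    have hm' : y - s ∉ (Icc (-r) r)ᶜ := fun h' => h' hm
    simp only [k₁, k₂, indicator_of_mem hm, indicator_of_notMem hm']
    nlinarith [h1 s h]
  · have hm : y - s ∉ Icc (-r) r := by
      intro hm; exact absurd (abs_le.2 ⟨by linarith [hm.2], by linarith [hm.1]⟩) (not_le.2 h)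
    have hm' : y - s ∈ (Icc (-r) r)ᶜ := hm
    simp only [k₁, k₂, indicator_of_notMem hm, indicator_of_mem hm']
    have := mul_le_mul_of_nonneg_left (h2 s h) h0
    nlinarith [this]

/-- One half of the self-improvement step in the Tauberian argument. -/
lemma le_of_abs_le_weight {u w : ℝ → ℝ} (hu : Integrable u) {r D P : ℝ} (hr : 1 ≤ r)
    (hrt : kernelTail r ≤ kernelMass r / 4) (hP : 0 ≤ P) (hw : ∀ z, 0 < w z)
    (hww : ∀ s z, w s ≤ w z * (2 + 2 * (s - z) ^ 2))
    (hv : ∀ y z, (∫ s, jacksonKernel (y - s) * u s) ≤ w z)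
    (hup : ∀ z, u z ≤ D * w z ∨ ∀ s ∈ Icc z (z + 2 * r), u z / 2 - D * w z ≤ u s)
    (hD : 0 ≤ D) (hlo : ∀ z, -(P * w z) ≤ u z) (z : ℝ) :
    u z ≤ (P / 2 + (2 / kernelMass r + 2 * D)) * w z := by
  have hm : 0 < kernelMass r := kernelMass_pos (by linarith)
  have hwz := hw z
  have hdiv : 0 < 2 / kernelMass r := by positivity
  rcases hup z with h | h
  · refine h.trans (mul_le_mul_of_nonneg_right ?_ hwz.le)
    linarith
  -- Centring at z + r makes the core of the kernel exactly the window [z, z + 2r].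
  · have key := le_integral_jacksonKernel_mul hu (y := z + r) (r := r) (β := u z / 2 - D * w z)
      (q := P * w z)
      (fun s hs => by
        rw [abs_le] at hs
        exact h s ⟨by linarith [hs.1], by linarith [hs.2]⟩)
      (fun s hs => by
        refine le_trans ?_ (hlo s)
        rw [neg_le_neg_iff, mul_assoc]
        refine mul_le_mul_of_nonneg_left ((hww s z).trans ?_) hP
        refine mul_le_mul_of_nonneg_left ?_ hwz.le
        -- Off the core r < |s - (z + r)|, so moving the base point costs a factor 2; its square
        -- turns 2 + 2(s - z)² into the tail weight 2 + 8(·)².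
        have h1 : |s - z| ≤ 2 * |s - (z + r)| := by
          have : |s - z| ≤ |s - (z + r)| + |r| := by
            have := abs_add_le (s - (z + r)) r
            rwa [show s - (z + r) + r = s - z by ring] at this
          rw [abs_of_nonneg (by linarith : 0 ≤ r)] at this
          linarith
        have h2 := pow_le_pow_left₀ (abs_nonneg _) h1 2
        rw [mul_pow, sq_abs, sq_abs] at h2
        linarith)
    have hv' := hv (z + r) z
    have h3 : P * w z * kernelTail r ≤ P * w z * (kernelMass r / 4) :=
      mul_le_mul_of_nonneg_left hrt (by positivity)
    have h4 : u z * kernelMass r ≤ (2 + 2 * D * kernelMass r + P / 2 * kernelMass r) * w z := by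
      nlinarith
    have h5 : (P / 2 + (2 / kernelMass r + 2 * D)) * w z =
        (2 + 2 * D * kernelMass r + P / 2 * kernelMass r) * w z / kernelMass r := by
      field_simp; ring
    rw [h5, le_div_iff₀ hm]
    exact h4

/-- A weighted Tauberian estimate: a function whose kernel means are at most `w` and which
neither decreases quickly to the right of its large values nor increases quickly from its large
negative values is of order `w`. -/
lemma abs_le_weight_of_kernel_means {u w : ℝ → ℝ} (hu : Integrable u) {r D : ℝ} (hr : 1 ≤ r)
    (hrt : kernelTail r ≤ kernelMass r / 4) (hw : ∀ z, 0 < w z)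
    (hww : ∀ s z, w s ≤ w z * (2 + 2 * (s - z) ^ 2))
    (hv : ∀ y z, |∫ s, jacksonKernel (y - s) * u s| ≤ w z)
    (hup : ∀ z, u z ≤ D * w z ∨ ∀ s ∈ Icc z (z + 2 * r), u z / 2 - D * w z ≤ u s)
    (hdn : ∀ z, -(D * w z) ≤ u z ∨ ∀ s ∈ Icc (z - 2 * r) z, u s ≤ u z / 2 + D * w z)
    (hD : 0 ≤ D) (hbd : ∃ P, ∀ z, |u z| ≤ P * w z) (z : ℝ) :
    |u z| ≤ 2 * (2 / kernelMass r + 2 * D) * w z := by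
  obtain ⟨P₀, hP₀⟩ := hbd
  set P := ⨆ z, |u z| / w z
  have hbdd : BddAbove (range fun z => |u z| / w z) :=
    ⟨P₀, by rintro _ ⟨z, rfl⟩; exact (div_le_iff₀ (hw z)).2 (hP₀ z)⟩
  have hPz : ∀ z, |u z| ≤ P * w z := fun z => (div_le_iff₀ (hw z)).1 (le_ciSup hbdd z)
  have hP : 0 ≤ P := Real.iSup_nonneg fun z => div_nonneg (abs_nonneg _) (hw z).le
  have hup' := le_of_abs_le_weight hu hr hrt hP hw hww
    (fun y z => (le_abs_self _).trans (hv y z)) hup hD (fun z => (abs_le.1 (hPz z)).1)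
  have hu' : Integrable fun s => -u (-s) := (hu.comp_neg).neg
  -- The lower bound is the upper bound for s ↦ -u(-s); the kernel is even.
  have hdn' := le_of_abs_le_weight (w := fun s => w (-s)) (D := D) hu' hr hrt hP (fun z => hw _)
    (fun s z => by
      have := hww (-s) (-z)
      rwa [show (-s - -z) ^ 2 = (s - z) ^ 2 by ring] at this)
    (fun y z => by
      have h1 : (∫ s, jacksonKernel (y - s) * -u (-s)) =
          -∫ s, jacksonKernel (-y - s) * u s := by
        rw [← integral_neg_eq_self, ← integral_neg]
        refine integral_congr_ae ?_
        filter_upwards with s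
        have : jacksonKernel (y - -s) = jacksonKernel (-y - s) := by
          unfold jacksonKernel
          rw [show (-y - s) / 4 = -((y - -s) / 4) by ring, Real.sinc_neg]
        simp only [this, neg_neg, mul_neg]
      rw [h1]
      exact (neg_le_abs _).trans (hv _ _))
    (fun z => by
      rcases hdn (-z) with h | h
      · left; linarith
      · right
        intro s hs
        have := h (-s) ⟨by linarith [hs.2], by linarith [hs.1]⟩
        linarith)
    hD (fun z => by linarith [(abs_le.1 (hPz (-z))).2])
  have himp : ∀ z, |u z| ≤ (P / 2 + (2 / kernelMass r + 2 * D)) * w z := fun z => by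
    have h1 := hdn' (-z)
    simp only [neg_neg] at h1
    exact abs_le.2 ⟨by linarith, hup' z⟩
  -- P is a supremum, so the improved pointwise bound applies to P itself and the halved P can be
  -- absorbed.
  have hPle : P ≤ P / 2 + (2 / kernelMass r + 2 * D) :=
    ciSup_le fun z => (div_le_iff₀ (hw z)).2 (himp z)
  refine (hPz z).trans (mul_le_mul_of_nonneg_right ?_ (hw z).le)
  linarith

/-! ### The exponential weight -/

/-- The weight `e^{-t/X} - e^{-2t/X}`. -/
def expWeight (X t : ℝ) : ℝ := Real.exp (-(t / X)) - Real.exp (-(2 * t / X))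

section expWeight

variable {X t s : ℝ}

lemma expWeight_eq : expWeight X t = Real.exp (-(t / X)) * (1 - Real.exp (-(t / X))) := by
  unfold expWeight
  rw [mul_sub, ← Real.exp_add]; congr 2 <;> ring_nf

lemma expWeight_zero : expWeight X 0 = 0 := by simp [expWeight]

lemma expWeight_le_exp : expWeight X t ≤ Real.exp (-(t / X)) := by
  unfold expWeight; linarith [Real.exp_pos (-(2 * t / X))]

lemma exp_neg_div_le_one (hX : 0 < X) (ht : 0 ≤ t) : Real.exp (-(t / X)) ≤ 1 :=
  Real.exp_le_one_iff.2 (by have := div_nonneg ht hX.le; linarith)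

lemma expWeight_nonneg (hX : 0 < X) (ht : 0 ≤ t) : 0 ≤ expWeight X t := by
  rw [expWeight_eq]
  exact mul_nonneg (Real.exp_pos _).le (by linarith [exp_neg_div_le_one hX ht])

lemma expWeight_le_one (hX : 0 < X) (ht : 0 ≤ t) : expWeight X t ≤ 1 :=
  expWeight_le_exp.trans (exp_neg_div_le_one hX ht)

lemma expWeight_mul_le (hX : 0 < X) (ht : 0 ≤ t) : expWeight X t * t ≤ X := by
  have h1 : expWeight X t * t ≤ Real.exp (-(t / X)) * t :=
    mul_le_mul_of_nonneg_right expWeight_le_exp ht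
  have h2 : t / X ≤ Real.exp (t / X) := by linarith [Real.add_one_le_exp (t / X)]
  rw [Real.exp_neg] at h1
  refine h1.trans ?_
  rw [inv_mul_le_iff₀ (Real.exp_pos _)]
  rwa [div_le_iff₀ hX] at h2

lemma exp_mul_expWeight_le (hX : 0 < X) (hts : t ≤ s) :
    Real.exp (-((s - t) / X)) * expWeight X t ≤ expWeight X s := by
  have h1 : Real.exp (-(s / X)) = Real.exp (-((s - t) / X)) * Real.exp (-(t / X)) := by
    rw [← Real.exp_add]; congr 1; ring
  have h2 : Real.exp (-(s / X)) ≤ Real.exp (-(t / X)) :=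
    Real.exp_le_exp.2 (neg_le_neg (div_le_div_of_nonneg_right hts hX.le))
  rw [expWeight_eq, expWeight_eq, ← mul_assoc, ← h1]
  exact mul_le_mul_of_nonneg_left (by linarith) (Real.exp_pos _).le

lemma half_expWeight_le (hX : 0 < X) (ht : 0 ≤ t) (hts : t ≤ s) (hs : s - t ≤ X / 2) :
    expWeight X t / 2 ≤ expWeight X s := by
  refine le_trans ?_ (exp_mul_expWeight_le hX hts)
  have h1 : (s - t) / X ≤ 1 / 2 := by rw [div_le_iff₀ hX]; linarith
  have h2 := Real.add_one_le_exp (-((s - t) / X))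
  nlinarith [expWeight_nonneg hX ht]

lemma third_expWeight_le (hX : 0 < X) (ht : 0 ≤ t) (hts : t ≤ s) (hs : s - t ≤ X) :
    expWeight X t / 3 ≤ expWeight X s := by
  refine le_trans ?_ (exp_mul_expWeight_le hX hts)
  have h1 : (s - t) / X ≤ 1 := by rw [div_le_iff₀ hX]; linarith
  have h2 : Real.exp (-1) ≤ Real.exp (-((s - t) / X)) := Real.exp_le_exp.2 (by linarith)
  have h3 : 1 / 3 ≤ Real.exp (-1) := by
    rw [Real.exp_neg, ← one_div]
    exact one_div_le_one_div_of_le (Real.exp_pos _) (by linarith [Real.exp_one_lt_d9])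
  nlinarith [expWeight_nonneg hX ht]

/-- Since the weight vanishes at 0, going backwards is controlled only for s ≥ t/2. With q =
e^{-t/(2X)} the claim reduces to (1 - q²)/2 ≤ 1 - q, true as q ≤ 1. -/
lemma half_expWeight_le_of_half_le (hX : 0 < X) (ht : 0 ≤ t) (hst : s ≤ t) (hs : t / 2 ≤ s) :
    expWeight X t / 2 ≤ expWeight X s := by
  rw [expWeight_eq, expWeight_eq]
  have h1 : Real.exp (-(t / X)) ≤ Real.exp (-(s / X)) :=
    Real.exp_le_exp.2 (neg_le_neg (div_le_div_of_nonneg_right hst hX.le))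
  set q := Real.exp (-(t / 2 / X))
  have h2 : Real.exp (-(s / X)) ≤ q :=
    Real.exp_le_exp.2 (neg_le_neg (div_le_div_of_nonneg_right hs hX.le))
  have h3 : Real.exp (-(t / X)) = q ^ 2 := by
    rw [← Real.exp_nat_mul]; congr 1; push_cast; ring
  have h4 : q ≤ 1 := exp_neg_div_le_one hX (by linarith)
  have h0 : 0 < Real.exp (-(t / X)) := Real.exp_pos _
  rw [mul_div_assoc]
  refine mul_le_mul h1 ?_ ?_ (Real.exp_pos _).le
  · rw [h3]; nlinarith
  · rw [h3]; nlinarith [Real.exp_pos (-(t / 2 / X))]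

lemma eighth_le_expWeight_self (hX : 0 < X) : 1 / 8 ≤ expWeight X X := by
  rw [expWeight_eq, div_self hX.ne', Real.exp_neg]
  have h1 := Real.exp_one_lt_d9
  have h2 := Real.exp_one_gt_d9
  rw [show (Real.exp 1)⁻¹ * (1 - (Real.exp 1)⁻¹) = (Real.exp 1 - 1) / (Real.exp 1) ^ 2 by
    field_simp, div_le_div_iff₀ (by norm_num) (by positivity)]
  nlinarith

end expWeight

/-! ### The Tauberian theorem on the logarithmic scale -/

/-- The data of the Tauberian problem on the logarithmic scale: `h` has controlled decrease, `H` is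
the expected main term, and `u` is the weighted difference. -/
structure TauberianData (N M B X T Q η δ₀ δ₁ : ℝ) (h H u : ℝ → ℝ) : Prop where
  one_le_X : 1 ≤ X
  T_pos : 0 < T
  two_le : 2 ≤ T * X
  one_le_Q : 1 ≤ Q
  eta_nonneg : 0 ≤ η
  delta₀_nonneg : 0 ≤ δ₀
  delta₁_nonneg : 0 ≤ δ₁
  delta₀_le : δ₀ ≤ N * (1 + 1 / T)
  decrease : ∀ t s, 0 ≤ t → t ≤ s → h t - (1 + T * (s - t)) * δ₀ ≤ h s
  decrease_far : ∀ t s, X / 2 ≤ t → t ≤ s → h t - (1 + T * (s - t)) * δ₁ ≤ h s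
  zero_le : -M ≤ h 0
  lower : ∀ t, 0 ≤ t → -M - N * (1 + t) ≤ h t
  main_le : ∀ t, 0 ≤ t → expWeight X t * |H t| ≤ B * Q
  main_osc : ∀ t s, X / 4 ≤ t → X / 4 ≤ s → |t - s| ≤ X →
    expWeight X t * |H t - H s| ≤ B * Q * |t - s|
  u_of_nonneg : ∀ t, 0 ≤ t → u t = expWeight X t * (h t - H t)
  u_of_neg : ∀ t, t < 0 → u t = 0
  integrable : Integrable u
  bounded : ∃ P, ∀ t, |u t| ≤ P
  means_le : ∀ y, |∫ s, jacksonKernel (y - s) * u (s / T)| ≤ 2 * η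

namespace TauberianData

variable {N M B X T Q η δ₀ δ₁ : ℝ} {h H u : ℝ → ℝ}

lemma X_pos (d : TauberianData N M B X T Q η δ₀ δ₁ h H u) : 0 < X := by linarith [d.one_le_X]

lemma Q_div_pos (d : TauberianData N M B X T Q η δ₀ δ₁ h H u) : 0 < Q / T :=
  div_pos (by linarith [d.one_le_Q]) d.T_pos

lemma integrable_scaled (d : TauberianData N M B X T Q η δ₀ δ₁ h H u) :
    Integrable fun z => u (z / T) := d.integrable.comp_div d.T_pos.ne'

lemma B_nonneg (d : TauberianData N M B X T Q η δ₀ δ₁ h H u) : 0 ≤ B := by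
  have h1 := d.main_le 0 le_rfl
  rw [expWeight_zero, zero_mul] at h1
  nlinarith [d.one_le_Q]

lemma abs_main_self_le (d : TauberianData N M B X T Q η δ₀ δ₁ h H u) : |H X| ≤ 8 * (B * Q) := by
  have h1 := d.main_le X d.X_pos.le
  have h2 := eighth_le_expWeight_self d.X_pos
  nlinarith [abs_nonneg (H X)]

/-- The right-hand alternative after a large value of `u`. -/
lemma right_alternative (d : TauberianData N M B X T Q η δ₀ δ₁ h H u) (hM : 0 ≤ M) {a t W : ℝ}
    (ha : 2 ≤ a) (haY : 4 * a ≤ T * X) (ht : 0 ≤ t)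
    (hW1 : δ₁ + Q / T ≤ W) (hW2 : t < 3 * X / 4 → δ₀ + M + Q ≤ 16 * W) :
    u t ≤ 16 * (2 + 2 * a + 2 * B + B * a) * W ∨ ∀ s ∈ Icc t (t + a / T),
      u t / 2 - 16 * (2 + 2 * a + 2 * B + B * a) * W ≤ u s := by
  have hX := d.X_pos
  have hT := d.T_pos
  have hB := d.B_nonneg
  have hQ := d.one_le_Q
  have hQT := d.Q_div_pos
  have hd0 := d.delta₀_nonneg
  have hd1 := d.delta₁_nonneg
  have haX : a / T ≤ X / 4 := by rw [div_le_iff₀ hT]; linarith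
  have hW0 : 0 < W := by linarith
  have hEt := expWeight_nonneg hX ht
  have hBa : 0 ≤ B * a := by positivity
  rcases le_or_gt (u t) 0 with hu | hu
  · left; exact hu.trans (by positivity)
  rw [d.u_of_nonneg t ht] at hu ⊢
  -- Before X/2 only δ₀ is known: h and H are bounded separately and the error goes into `hW2`. From
  -- X/2 on, δ₁ and the oscillation bound act on h - H as a whole.
  rcases lt_or_ge t (X / 2) with htX | htX
  · have hW := hW2 (by linarith)
    have hHt := d.main_le t ht
    have hBQ : B * Q ≤ B * (16 * W) := mul_le_mul_of_nonneg_left (by linarith) hB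
    rcases le_or_gt (h t) 0 with hh | hh
    · left
      have h1 : expWeight X t * (h t - H t) ≤ B * Q := by
        nlinarith [neg_abs_le (H t), mul_nonneg hEt (neg_nonneg.2 hh)]
      linarith [mul_nonneg hBa hW0.le, mul_nonneg (by linarith : 0 ≤ a) hW0.le,
        mul_nonneg hB hW0.le]
    · right
      rintro s ⟨hs1, hs2⟩
      have hs0 : 0 ≤ s := ht.trans hs1
      rw [d.u_of_nonneg s hs0]
      have hE := half_expWeight_le hX ht hs1 (by linarith)
      have hEs := expWeight_nonneg hX hs0
      have hE1 := expWeight_le_one hX hs0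
      have hHs := d.main_le s hs0
      have hTs : T * (s - t) ≤ a := by
        have : s - t ≤ a / T := by linarith
        rw [le_div_iff₀ hT] at this; linarith
      have hdec := d.decrease t s ht hs1
      have h1 : h t - (1 + a) * δ₀ ≤ h s := by nlinarith
      have h2 : expWeight X s * (h t - (1 + a) * δ₀) ≤ expWeight X s * h s :=
        mul_le_mul_of_nonneg_left h1 hEs
      have h3 : expWeight X t / 2 * h t ≤ expWeight X s * h t :=
        mul_le_mul_of_nonneg_right hE hh.le
      have h4 : expWeight X s * ((1 + a) * δ₀) ≤ (1 + a) * δ₀ :=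
        mul_le_of_le_one_left (by positivity) hE1
      have h5 : expWeight X s * H s ≤ B * Q :=
        (mul_le_mul_of_nonneg_left (le_abs_self _) hEs).trans hHs
      have h6 : -(B * Q) ≤ expWeight X t * H t := by
        have := mul_le_mul_of_nonneg_left (neg_abs_le (H t)) hEt
        linarith
      have h7 : (1 + a) * δ₀ ≤ (1 + a) * (16 * W) :=
        mul_le_mul_of_nonneg_left (by linarith) (by linarith)
      linarith [mul_nonneg hBa hW0.le, mul_nonneg (by linarith : 0 ≤ a) hW0.le,
        mul_nonneg hB hW0.le]
  · right
    rintro s ⟨hs1, hs2⟩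
    have hs0 : 0 ≤ s := ht.trans hs1
    rw [d.u_of_nonneg s hs0]
    have hE := half_expWeight_le hX ht hs1 (by linarith)
    have hEs := expWeight_nonneg hX hs0
    have hE1 := expWeight_le_one hX hs0
    have hTs : T * (s - t) ≤ a := by
      have : s - t ≤ a / T := by linarith
      rw [le_div_iff₀ hT] at this; linarith
    have hdec := d.decrease_far t s htX hs1
    have h1 : h t - (1 + a) * δ₁ ≤ h s := by nlinarith
    have hosc := d.main_osc s t (by linarith) (by linarith)
      (by rw [abs_of_nonneg (by linarith)]; linarith)
    rw [abs_of_nonneg (by linarith : 0 ≤ s - t)] at hosc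
    have h2 : B * Q * (s - t) ≤ B * a * (Q / T) := by
      have : B * a * (Q / T) = B * Q * (a / T) := by ring
      rw [this]
      exact mul_le_mul_of_nonneg_left (by linarith) (by positivity)
    have hpos : 0 < h t - H t := by
      by_contra hcon
      nlinarith
    have h3 : expWeight X t / 2 * (h t - H t) ≤ expWeight X s * (h t - H t) :=
      mul_le_mul_of_nonneg_right hE hpos.le
    have h4 : expWeight X s * ((1 + a) * δ₁) ≤ (1 + a) * δ₁ :=
      mul_le_of_le_one_left (by positivity) hE1
    have h5 : expWeight X s * (H s - H t) ≤ B * a * (Q / T) :=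
      (mul_le_mul_of_nonneg_left (le_abs_self _) hEs).trans (hosc.trans h2)
    have h6 : expWeight X s * (h t - (1 + a) * δ₁) ≤ expWeight X s * h s :=
      mul_le_mul_of_nonneg_left h1 hEs
    have h7 : (1 + a) * δ₁ ≤ (1 + a) * W := mul_le_mul_of_nonneg_left (by linarith) (by linarith)
    have h8 : B * a * (Q / T) ≤ B * a * W := mul_le_mul_of_nonneg_left (by linarith) hBa
    linarith [mul_nonneg hBa hW0.le, mul_nonneg (by linarith : 0 ≤ a) hW0.le,
        mul_nonneg hB hW0.le]

/-- The left-hand alternative before a large negative value of `u`. -/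
lemma left_alternative (d : TauberianData N M B X T Q η δ₀ δ₁ h H u) (hM : 0 ≤ M) {a t W : ℝ}
    (ha : 2 ≤ a) (haY : 4 * a ≤ T * X) (ht : 0 ≤ t)
    (hW1 : δ₁ + Q / T ≤ W) (hW2 : t < 3 * X / 4 → δ₀ + M + Q ≤ 16 * W) :
    -(16 * (2 + 2 * a + 2 * B + B * a) * W) ≤ u t ∨ ∀ s ∈ Icc (t - a / T) t,
      u s ≤ u t / 2 + 16 * (2 + 2 * a + 2 * B + B * a) * W := by
  have hX := d.X_pos
  have hT := d.T_pos
  have hB := d.B_nonneg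
  have hQ := d.one_le_Q
  have hQT := d.Q_div_pos
  have hd0 := d.delta₀_nonneg
  have hd1 := d.delta₁_nonneg
  have haX : a / T ≤ X / 4 := by rw [div_le_iff₀ hT]; linarith
  have hW0 : 0 < W := by linarith
  have hEt := expWeight_nonneg hX ht
  have hEt1 := expWeight_le_one hX ht
  have hBa : 0 ≤ B * a := by positivity
  rcases le_or_gt 0 (u t) with hu | hu
  · left; exact le_trans (by rw [neg_nonpos]; positivity) hu
  rw [d.u_of_nonneg t ht] at hu ⊢
  -- The split lies at 3X/4 so that the whole left window, of length at most X/4, stays in the range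
  -- t ≥ X/2 of `decrease_far`.
  rcases lt_or_ge t (3 * X / 4) with htX | htX
  · have hW := hW2 htX
    have hHt := d.main_le t ht
    have hBQ : B * Q ≤ B * (16 * W) := mul_le_mul_of_nonneg_left (by linarith) hB
    have hHt' : expWeight X t * H t ≤ B * Q :=
      (mul_le_mul_of_nonneg_left (le_abs_self _) hEt).trans hHt
    rcases le_or_gt 0 (h t) with hh | hh
    · left
      linarith [mul_nonneg hEt hh, mul_nonneg hBa hW0.le,
        mul_nonneg (by linarith : 0 ≤ a) hW0.le, mul_nonneg hB hW0.le]
    -- For t ≤ 2a/T the left window may cross 0 or violate s ≥ t/2; there h(t) is bounded below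
    -- directly from h(0).
    rcases le_or_gt t (2 * (a / T)) with hta | hta
    · left
      have hdec := d.decrease 0 t le_rfl ht
      have hz := d.zero_le
      have hTt : T * (t - 0) ≤ 2 * a := by
        have : T * (2 * (a / T)) = 2 * a := by field_simp
        nlinarith
      have h1 : -(M + (1 + 2 * a) * δ₀) ≤ h t := by nlinarith
      have h2 : -(M + (1 + 2 * a) * δ₀) ≤ expWeight X t * h t := by nlinarith
      have h3 : M + (1 + 2 * a) * δ₀ ≤ (1 + 2 * a) * (16 * W) := by nlinarith
      linarith [mul_nonneg hBa hW0.le, mul_nonneg (by linarith : 0 ≤ a) hW0.le,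
        mul_nonneg hB hW0.le]
    · right
      rintro s ⟨hs1, hs2⟩
      have hs0 : 0 ≤ s := by linarith
      rw [d.u_of_nonneg s hs0]
      have hE := half_expWeight_le_of_half_le hX ht hs2 (by linarith)
      have hEs := expWeight_nonneg hX hs0
      have hE1 := expWeight_le_one hX hs0
      have hHs := d.main_le s hs0
      have hTs : T * (t - s) ≤ a := by
        have : t - s ≤ a / T := by linarith
        rw [le_div_iff₀ hT] at this; linarith
      have hdec := d.decrease s t hs0 hs2
      have h1 : h s ≤ h t + (1 + a) * δ₀ := by nlinarith
      have h2 : expWeight X s * h s ≤ expWeight X s * (h t + (1 + a) * δ₀) :=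
        mul_le_mul_of_nonneg_left h1 hEs
      have h3 : expWeight X s * h t ≤ expWeight X t / 2 * h t :=
        mul_le_mul_of_nonpos_right hE hh.le
      have h4 : expWeight X s * ((1 + a) * δ₀) ≤ (1 + a) * δ₀ :=
        mul_le_of_le_one_left (by positivity) hE1
      have h5 : -(B * Q) ≤ expWeight X s * H s := by
        have := mul_le_mul_of_nonneg_left (neg_abs_le (H s)) hEs
        linarith
      have h7 : (1 + a) * δ₀ ≤ (1 + a) * (16 * W) :=
        mul_le_mul_of_nonneg_left (by linarith) (by linarith)
      linarith [mul_nonneg hBa hW0.le, mul_nonneg (by linarith : 0 ≤ a) hW0.le,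
        mul_nonneg hB hW0.le]
  · right
    rintro s ⟨hs1, hs2⟩
    have hs0 : 0 ≤ s := by linarith
    rw [d.u_of_nonneg s hs0]
    have hE := half_expWeight_le_of_half_le hX ht hs2 (by linarith)
    have hEs := expWeight_nonneg hX hs0
    have hE1 := expWeight_le_one hX hs0
    have hTs : T * (t - s) ≤ a := by
      have : t - s ≤ a / T := by linarith
      rw [le_div_iff₀ hT] at this; linarith
    have hdec := d.decrease_far s t (by linarith) hs2
    have h1 : h s ≤ h t + (1 + a) * δ₁ := by nlinarith
    have hosc := d.main_osc s t (by linarith) (by linarith)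
      (by rw [abs_sub_comm, abs_of_nonneg (by linarith)]; linarith)
    rw [abs_sub_comm s t, abs_of_nonneg (by linarith : 0 ≤ t - s)] at hosc
    have h2 : B * Q * (t - s) ≤ B * a * (Q / T) := by
      have : B * a * (Q / T) = B * Q * (a / T) := by ring
      rw [this]
      exact mul_le_mul_of_nonneg_left (by linarith) (by positivity)
    have hneg : h t - H t < 0 := by
      by_contra hcon
      nlinarith
    have h3 : expWeight X s * (h t - H t) ≤ expWeight X t / 2 * (h t - H t) :=
      mul_le_mul_of_nonpos_right hE hneg.le
    have h4 : expWeight X s * ((1 + a) * δ₁) ≤ (1 + a) * δ₁ :=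
      mul_le_of_le_one_left (by positivity) hE1
    have h5 : -(B * a * (Q / T)) ≤ expWeight X s * (H s - H t) := by
      have := mul_le_mul_of_nonneg_left (neg_abs_le (H s - H t)) hEs
      linarith
    have h6 : expWeight X s * h s ≤ expWeight X s * (h t + (1 + a) * δ₁) :=
      mul_le_mul_of_nonneg_left h1 hEs
    have h7 : (1 + a) * δ₁ ≤ (1 + a) * W := mul_le_mul_of_nonneg_left (by linarith) (by linarith)
    have h8 : B * a * (Q / T) ≤ B * a * W := mul_le_mul_of_nonneg_left (by linarith) hBa
    linarith [mul_nonneg hBa hW0.le, mul_nonneg (by linarith : 0 ≤ a) hW0.le,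
        mul_nonneg hB hW0.le]

end TauberianData

namespace TauberianData

variable {N M B X T Q η δ₀ δ₁ : ℝ} {h H u : ℝ → ℝ}

/-- The Tauberian estimate when `T X` is large. -/
lemma abs_u_le (d : TauberianData N M B X T Q η δ₀ δ₁ h H u) (hM : 0 ≤ M) {r : ℝ}
    (hr : 1 ≤ r) (hrt : kernelTail r ≤ kernelMass r / 4) (hrX : 8 * r ≤ T * X) :
    |u X| ≤ 2 * (2 / kernelMass r + 2 * (16 * (2 + 2 * (2 * r) + 2 * B + B * (2 * r)))) *
      (2 * η + δ₁ + Q / T + (2 * η + δ₀ + M + Q) / (T * X) ^ 2) := by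
  have hX := d.X_pos
  have hT := d.T_pos
  have hB := d.B_nonneg
  have hQ := d.one_le_Q
  have hQT := d.Q_div_pos
  have hd0 := d.delta₀_nonneg
  have hd1 := d.delta₁_nonneg
  have hη := d.eta_nonneg
  set Y := T * X with hY
  have hYpos : 0 < Y := by positivity
  set S := 2 * η + δ₀ + M + Q with hS
  have hS0 : 0 < S := by linarith
  -- The last summand ensures S/Y² ≤ b, which is what yields w(s) ≤ w(z)(2 + 2(s - z)²).
  set b := 2 * η + δ₁ + Q / T + S / Y ^ 2 with hb
  have hSY : 0 < S / Y ^ 2 := by positivity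
  set w : ℝ → ℝ := fun z => b + S * ((z - Y) / Y) ^ 2 with hw
  have hwb : ∀ z, b ≤ w z := fun z => by
    have : 0 ≤ S * ((z - Y) / Y) ^ 2 := by positivity
    simp only [hw]; linarith
  have hb0 : 0 < b := by linarith
  -- Here |z - Y| ≥ Y/4, so the parabola alone contributes at least S/16.
  have hW2 : ∀ z, 0 ≤ z → z / T < 3 * X / 4 → δ₀ + M + Q ≤ 16 * w z := by
    intro z _ hz
    rw [div_lt_iff₀ hT] at hz
    have h1 : (z - Y) / Y ≤ -(1 / 4) := by
      rw [div_le_iff₀ hYpos]; linarith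
    have h2 : 1 / 16 ≤ ((z - Y) / Y) ^ 2 := by nlinarith
    have h3 : S * (1 / 16) ≤ S * ((z - Y) / Y) ^ 2 := mul_le_mul_of_nonneg_left h2 hS0.le
    simp only [hw]; linarith
  have hneg : ∀ z, z < 0 → u (z / T) = 0 := fun z hz => d.u_of_neg _ (div_neg_of_neg_of_pos hz hT)
  have hD : 0 ≤ 16 * (2 + 2 * (2 * r) + 2 * B + B * (2 * r)) := by positivity
  have hDw : ∀ z, 0 ≤ 16 * (2 + 2 * (2 * r) + 2 * B + B * (2 * r)) * w z := fun z =>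
    mul_nonneg hD (hb0.le.trans (hwb z))
  have key := abs_le_weight_of_kernel_means d.integrable_scaled hr hrt
    (fun z => hb0.trans_le (hwb z)) (w := w)
    (fun s z => by
      have e1 : (s - Y) / Y = (z - Y) / Y + (s - z) / Y := by ring
      have e2 : S * ((s - z) / Y) ^ 2 = S / Y ^ 2 * (s - z) ^ 2 := by ring
      have h1 : S / Y ^ 2 * (s - z) ^ 2 ≤ b * (s - z) ^ 2 :=
        mul_le_mul_of_nonneg_right (by linarith) (sq_nonneg _)
      have h2 : S * ((z - Y) / Y + (s - z) / Y) ^ 2 ≤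
          2 * (S * ((z - Y) / Y) ^ 2) + 2 * (S * ((s - z) / Y) ^ 2) := by
        nlinarith [mul_nonneg hS0.le (sq_nonneg ((z - Y) / Y - (s - z) / Y))]
      have h3 : 0 ≤ S * ((z - Y) / Y) ^ 2 := by positivity
      have h4 : 0 ≤ S * ((z - Y) / Y) ^ 2 * (s - z) ^ 2 := by positivity
      simp only [hw]
      rw [e1]
      linarith)
    (fun y z => (d.means_le y).trans (le_trans (by linarith) (hwb z)))
    (D := 16 * (2 + 2 * (2 * r) + 2 * B + B * (2 * r)))
    (fun z => by
      rcases lt_or_ge z 0 with hz | hz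
      · left; rw [hneg z hz]; exact hDw z
      · rcases d.right_alternative hM (a := 2 * r) (t := z / T) (W := w z) (by linarith)
          (by linarith) (by positivity) (le_trans (by linarith) (hwb z)) (hW2 z hz) with h1 | h1
        · exact Or.inl h1
        · right
          intro s hs
          refine h1 (s / T) ⟨div_le_div_of_nonneg_right hs.1 hT.le, ?_⟩
          rw [← add_div]
          exact div_le_div_of_nonneg_right hs.2 hT.le)
    (fun z => by
      rcases lt_or_ge z 0 with hz | hz
      · left; rw [hneg z hz]; exact neg_nonpos.2 (hDw z)
      · rcases d.left_alternative hM (a := 2 * r) (t := z / T) (W := w z) (by linarith)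
          (by linarith) (by positivity) (le_trans (by linarith) (hwb z)) (hW2 z hz) with h1 | h1
        · exact Or.inl h1
        · right
          intro s hs
          refine h1 (s / T) ⟨?_, div_le_div_of_nonneg_right hs.2 hT.le⟩
          rw [← sub_div]
          exact div_le_div_of_nonneg_right hs.1 hT.le)
    hD
    (by
      obtain ⟨P, hP⟩ := d.bounded
      have hP0 : 0 ≤ P := (abs_nonneg _).trans (hP 0)
      refine ⟨P / b, fun z => (hP _).trans ?_⟩
      rw [div_mul_eq_mul_div, le_div_iff₀ hb0]
      exact mul_le_mul_of_nonneg_left (hwb z) hP0)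
    Y
  have e1 : Y / T = X := by rw [hY]; field_simp
  have e2 : w Y = b := by simp [hw]
  rw [e1, e2] at key
  exact key

/-- From TX ≥ 2 and X ≥ 1, the factor 1/(TX)² is at most both 1 and 1/T. Thus δ₀, M and Q, relevant
only far from X, are absorbed into Q/T, and η into itself. -/
lemma error_weight_le (d : TauberianData N M B X T Q η δ₀ δ₁ h H u) (hM : 0 ≤ M) (hN : 0 ≤ N) :
    2 * η + δ₁ + Q / T + (2 * η + δ₀ + M + Q) / (T * X) ^ 2 ≤
      (M + 2 * N + 4) * (η + δ₁ + Q / T) := by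
  have hT := d.T_pos
  have hQ := d.one_le_Q
  have hQT := d.Q_div_pos
  have hY := d.two_le
  have hY1 : 1 / (T * X) ^ 2 ≤ 1 := by
    rw [div_le_one (by positivity)]; nlinarith
  have hY2 : 1 / (T * X) ^ 2 ≤ 1 / T := by
    refine one_div_le_one_div_of_le hT ?_
    nlinarith [d.one_le_X]
  have h0 : 0 ≤ 1 / (T * X) ^ 2 := by positivity
  have hd := d.delta₀_le
  have hT1 : 0 < 1 / T := by positivity
  have h1T : 1 / T ≤ Q / T := div_le_div_of_nonneg_right hQ hT.le
  have e : (2 * η + δ₀ + M + Q) / (T * X) ^ 2 = 2 * η * (1 / (T * X) ^ 2) +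
      δ₀ * (1 / (T * X) ^ 2) + (M + Q) * (1 / (T * X) ^ 2) := by ring
  have h2 : 2 * η * (1 / (T * X) ^ 2) ≤ 2 * η :=
    mul_le_of_le_one_right (by linarith [d.eta_nonneg]) hY1
  have h3 : δ₀ * (1 / (T * X) ^ 2) ≤ 2 * N * (Q / T) := by
    have h31 : δ₀ * (1 / (T * X) ^ 2) ≤ N * (1 + 1 / T) * (1 / (T * X) ^ 2) :=
      mul_le_mul_of_nonneg_right hd h0
    have h32 : N * (1 / (T * X) ^ 2) ≤ N * (Q / T) :=
      mul_le_mul_of_nonneg_left (hY2.trans h1T) hN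
    have h33 : N * (1 / T) * (1 / (T * X) ^ 2) ≤ N * (Q / T) :=
      (mul_le_of_le_one_right (by positivity) hY1).trans (mul_le_mul_of_nonneg_left h1T hN)
    linarith
  have h4 : (M + Q) * (1 / (T * X) ^ 2) ≤ (M + 1) * (Q / T) := by
    have h41 : (M + Q) * (1 / (T * X) ^ 2) ≤ (M + Q) * (1 / T) :=
      mul_le_mul_of_nonneg_left hY2 (by linarith)
    have h42 : M * (1 / T) ≤ M * (Q / T) := mul_le_mul_of_nonneg_left h1T hM
    have h43 : Q * (1 / T) = Q / T := by ring
    linarith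
  have hη := d.eta_nonneg
  have hd1 := d.delta₁_nonneg
  rw [e]
  have h5 : 0 ≤ (M + 2 * N) * η := by positivity
  have h6 : 0 ≤ (M + 2 * N) * δ₁ := by positivity
  linarith

/-- A crude bound for the tail of the kernel, sufficient when X is O(1/T); the linear growth of the
lower bound for h costs only X because t times the weight is at most X. -/
lemma neg_le_u (d : TauberianData N M B X T Q η δ₀ δ₁ h H u) (hM : 0 ≤ M) (hN : 0 ≤ N) (t : ℝ) :
    -((M + 2 * N + B) * (Q * X)) ≤ u t := by
  have hX := d.X_pos
  have hQ := d.one_le_Q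
  have hB := d.B_nonneg
  rcases lt_or_ge t 0 with ht | ht
  · rw [d.u_of_neg _ ht, neg_nonpos]; positivity
  · rw [d.u_of_nonneg _ ht]
    have hEs := expWeight_nonneg hX ht
    have hE1 := expWeight_le_one hX ht
    have h1 := mul_le_mul_of_nonneg_left (d.lower _ ht) hEs
    have h2 := mul_le_mul_of_nonneg_left (expWeight_mul_le hX ht) hN
    have h3 : expWeight X t * H t ≤ B * Q :=
      (mul_le_mul_of_nonneg_left (le_abs_self _) hEs).trans (d.main_le _ ht)
    have h4 : expWeight X t * (M + N) ≤ M + N :=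
      mul_le_of_le_one_left (by positivity) hE1
    have h6 : X ≤ Q * X := le_mul_of_one_le_left hX.le hQ
    have h5 : 1 ≤ Q * X := d.one_le_X.trans h6
    have h7 : Q ≤ Q * X := le_mul_of_one_le_right (by linarith) d.one_le_X
    have h8 := mul_le_mul_of_nonneg_left h5 (add_nonneg hM hN)
    have h9 := mul_le_mul_of_nonneg_left h6 hN
    have h10 := mul_le_mul_of_nonneg_left h7 hB
    linarith

/-- The Tauberian estimate when `T X` is bounded. -/
lemma abs_sub_le_of_bounded (d : TauberianData N M B X T Q η δ₀ δ₁ h H u) (hM : 0 ≤ M)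
    (hN : 0 ≤ N) {A₀ : ℝ} (hA : 1 ≤ A₀) (hAX : T * X ≤ A₀) :
    |h X - H X| ≤ (M + 2 * N + 72 * N + 32 * B +
      24 * (2 + (M + 2 * N + B) * kernelTail 1) / kernelMass 1) * (2 * A₀) *
        (η + Q / T) := by
  have hX := d.X_pos
  have hX1 := d.one_le_X
  have hT := d.T_pos
  have hB := d.B_nonneg
  have hQ := d.one_le_Q
  have hQT := d.Q_div_pos
  have hη := d.eta_nonneg
  have hd0 := d.delta₀_nonneg
  have hm : 0 < kernelMass 1 := kernelMass_pos one_pos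
  have hk := kernelTail_nonneg 1
  -- The point of this case: X, Q and QX are all O(Q/T), so crude bounds lose only a constant.
  have hXT : X ≤ A₀ * (1 / T) := by rw [mul_one_div, le_div_iff₀ hT]; linarith
  have hEX := eighth_le_expWeight_self hX
  have hHX := d.abs_main_self_le
  set R := η + Q / T with hR
  have hR0 : 0 < R := by linarith
  have h1T : 1 / T ≤ Q / T := div_le_div_of_nonneg_right hQ hT.le
  have hA1 : 1 ≤ A₀ * (1 / T) := hX1.trans hXT
  have hAQ : 0 ≤ A₀ * (Q / T) := by positivity
  have hAη : 0 ≤ A₀ * η := by positivity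
  have hAR : A₀ * (Q / T) ≤ 2 * A₀ * R := by rw [hR]; linarith
  have hAT : A₀ * (1 / T) ≤ A₀ * (Q / T) := mul_le_mul_of_nonneg_left h1T (by linarith)
  have hXR : X ≤ 2 * A₀ * R := by linarith
  have hQX : Q * X ≤ 2 * A₀ * R := by
    have : Q * X ≤ Q * (A₀ * (1 / T)) := mul_le_mul_of_nonneg_left hXT (by linarith)
    have e : Q * (A₀ * (1 / T)) = A₀ * (Q / T) := by ring
    linarith
  have hQR : Q ≤ 2 * A₀ * R := (le_mul_of_one_le_right (by linarith) hX1).trans hQX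
  have hδR : δ₀ ≤ N * (2 * A₀ * R) := by
    refine d.delta₀_le.trans (mul_le_mul_of_nonneg_left ?_ hN)
    have : 1 / T ≤ A₀ * (1 / T) := le_mul_of_one_le_left (by positivity) hA
    have e : 2 * A₀ * R = 2 * (A₀ * η) + 2 * (A₀ * (Q / T)) := by rw [hR]; ring
    linarith
  set U := 2 * A₀ * R with hU
  have hU0 : 0 < U := by positivity
  have hlow : -((M + 2 * N) * U) ≤ h X := by
    have := d.lower X hX.le
    have h1 : M + N * (1 + X) ≤ (M + 2 * N) * X := by
      have := mul_le_mul_of_nonneg_left hX1 (add_nonneg hM hN)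
      linarith
    have h2 : (M + 2 * N) * X ≤ (M + 2 * N) * U := mul_le_mul_of_nonneg_left hXR (by positivity)
    linarith
  have hHU : |H X| ≤ 8 * B * U := by
    have : B * Q ≤ B * U := mul_le_mul_of_nonneg_left hQR hB
    linarith
  have hextra : 0 ≤ 24 * (2 + (M + 2 * N + B) * kernelTail 1) / kernelMass 1 * U := by
    have : 0 ≤ (M + 2 * N + B) * kernelTail 1 := by positivity
    positivity
  have hNU : 0 ≤ N * U := by positivity
  have hBU : 0 ≤ B * U := by positivity
  have hMU : 0 ≤ M * U := by positivity
  have hup : h X ≤ (72 * N + 24 * B +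
      24 * (2 + (M + 2 * N + B) * kernelTail 1) / kernelMass 1) * U := by
    rcases le_or_gt (h X) 0 with hh | hh
    · exact hh.trans (by linarith)
    set q := (M + 2 * N + B) * (Q * X) with hq
    have hqU : q ≤ (M + 2 * N + B) * U := mul_le_mul_of_nonneg_left hQX (by positivity)
    have hq0 : 0 ≤ q := by positivity
    -- One mean with core [X, X + 2/T]. The coefficient 1/24 is 1/8 for the weight at X times 1/3
    -- for its loss over the core, and 3δ₀ is (1 + 2)δ₀.
    have key := le_integral_jacksonKernel_mul d.integrable_scaled (y := T * X + 1) (r := 1)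
      (β := h X / 24 - 3 * δ₀ - B * Q) (q := q)
      (fun s hs => by
        rw [abs_le] at hs
        have hs1 : X ≤ s / T := by rw [le_div_iff₀ hT]; linarith [hs.1]
        have hs2 : T * (s / T - X) ≤ 2 := by
          have : T * (s / T) = s := by field_simp
          rw [mul_sub, this]; linarith [hs.2]
        -- TX ≥ 2 makes the core no longer than X, as the factor 1/3 requires.
        have hs3 : s / T - X ≤ X := by
          have := d.two_le
          nlinarith
        have hs0 : 0 ≤ s / T := hX.le.trans hs1
        rw [d.u_of_nonneg _ hs0]
        have hE := third_expWeight_le hX hX.le hs1 hs3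
        have hEs := expWeight_nonneg hX hs0
        have hE1 := expWeight_le_one hX hs0
        have hdec := d.decrease X (s / T) hX.le hs1
        have h1 : h X - 3 * δ₀ ≤ h (s / T) := by nlinarith
        have h2 : expWeight X (s / T) * (h X - 3 * δ₀) ≤ expWeight X (s / T) * h (s / T) :=
          mul_le_mul_of_nonneg_left h1 hEs
        have h3 : 1 / 24 * h X ≤ expWeight X (s / T) * h X :=
          mul_le_mul_of_nonneg_right (by linarith) hh.le
        have h4 : expWeight X (s / T) * (3 * δ₀) ≤ 3 * δ₀ :=
          mul_le_of_le_one_left (by positivity) hE1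
        have h5 : expWeight X (s / T) * H (s / T) ≤ B * Q :=
          (mul_le_mul_of_nonneg_left (le_abs_self _) hEs).trans (d.main_le _ hs0)
        linarith)
      (fun s _ => by
        have h0 : -q ≤ u (s / T) := d.neg_le_u hM hN _
        linarith [mul_nonneg hq0 (sq_nonneg (s - (T * X + 1)))])
    have hv := (le_abs_self _).trans (d.means_le (T * X + 1))
    have h1 := key.trans hv
    have h2 : q * kernelTail 1 ≤ (M + 2 * N + B) * U * kernelTail 1 :=
      mul_le_mul_of_nonneg_right hqU hk
    have h3 : (h X / 24 - 3 * δ₀ - B * Q) ≤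
        (2 + (M + 2 * N + B) * kernelTail 1) / kernelMass 1 * U := by
      rw [div_mul_eq_mul_div, le_div_iff₀ hm]
      have hηU : η ≤ U := by
        have h5 : η ≤ A₀ * η := le_mul_of_one_le_left hη hA
        have e : U = 2 * (A₀ * η) + 2 * (A₀ * (Q / T)) := by rw [hU, hR]; ring
        linarith
      linarith
    have h4 : B * Q ≤ B * U := mul_le_mul_of_nonneg_left hQR hB
    have e : 24 * (2 + (M + 2 * N + B) * kernelTail 1) / kernelMass 1 * U =
      24 * ((2 + (M + 2 * N + B) * kernelTail 1) / kernelMass 1 * U) := by ring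
    rw [add_mul, e]
    linarith
  have e : (M + 2 * N + 72 * N + 32 * B +
      24 * (2 + (M + 2 * N + B) * kernelTail 1) / kernelMass 1) * (2 * A₀) * R =
      (M + 2 * N + 72 * N + 32 * B +
      24 * (2 + (M + 2 * N + B) * kernelTail 1) / kernelMass 1) * U := by rw [hU]; ring
  rw [e]
  rw [abs_le] at hHU ⊢
  constructor
  · linarith [hHU.2]
  · linarith [hHU.1]

end TauberianData

/-- The effective Tauberian theorem on the logarithmic scale. -/
theorem exists_tauberian_constant (N M B : ℝ) (hN : 0 ≤ N) (hM : 0 ≤ M) (hB : 0 ≤ B) :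
    ∃ C : ℝ, 0 < C ∧ ∀ (X T Q η δ₀ δ₁ : ℝ) (h H u : ℝ → ℝ),
      TauberianData N M B X T Q η δ₀ δ₁ h H u → |h X - H X| ≤ C * (η + δ₁ + Q / T) := by
  obtain ⟨r, hr, hrt⟩ := exists_kernelTail_le
  have hmr : 0 < kernelMass r := kernelMass_pos (by linarith)
  have hm1 : 0 < kernelMass 1 := kernelMass_pos one_pos
  have hk := kernelTail_nonneg 1
  set C₁ := 8 * (2 * (2 / kernelMass r + 2 * (16 * (2 + 2 * (2 * r) + 2 * B + B * (2 * r)))) *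
    (M + 2 * N + 4)) with hC₁
  set C₂ := (M + 2 * N + 72 * N + 32 * B +
      24 * (2 + (M + 2 * N + B) * kernelTail 1) / kernelMass 1) * (2 * (8 * r)) with hC₂
  have h1 : 0 < C₁ := by positivity
  have h2 : 0 < C₂ := by positivity
  refine ⟨C₁ + C₂, by positivity, fun X T Q η δ₀ δ₁ h H u d => ?_⟩
  have hQT := d.Q_div_pos
  have hη := d.eta_nonneg
  have hd1 := d.delta₁_nonneg
  have hsum : 0 < η + δ₁ + Q / T := by linarith
  rw [add_mul]
  -- The window in the z variable has length a = 2r, and the alternatives require 4a ≤ TX.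
  rcases le_total (8 * r) (T * X) with hX | hX
  · have h3 := d.abs_u_le hM hr hrt hX
    have h4 := d.error_weight_le hM hN
    have h5 := mul_le_mul_of_nonneg_left h4 (by positivity : 0 ≤ 2 * (2 / kernelMass r +
      2 * (16 * (2 + 2 * (2 * r) + 2 * B + B * (2 * r)))))
    have h6 := eighth_le_expWeight_self d.X_pos
    rw [d.u_of_nonneg X d.X_pos.le, abs_mul, abs_of_nonneg (by linarith)] at h3
    have h7 : 1 / 8 * |h X - H X| ≤ expWeight X X * |h X - H X| :=
      mul_le_mul_of_nonneg_right h6 (abs_nonneg _)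
    have h8 : |h X - H X| ≤ C₁ * (η + δ₁ + Q / T) := by rw [hC₁]; linarith
    linarith [mul_pos h2 hsum]
  · have h3 := d.abs_sub_le_of_bounded hM hN (by linarith) hX
    have h4 : C₂ * (η + Q / T) ≤ C₂ * (η + δ₁ + Q / T) :=
      mul_le_mul_of_nonneg_left (by linarith) h2.le
    linarith [mul_pos h1 hsum]

/-! ### Partial integration in the Stieltjes integral -/

lemma exp_sub_exp_le (x y : ℝ) : Real.exp y - Real.exp x ≤ Real.exp y * (y - x) := by
  have h1 := Real.add_one_le_exp (x - y)
  have h2 : Real.exp x = Real.exp y * Real.exp (x - y) := by rw [← Real.exp_add]; congr 1; ring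
  nlinarith [Real.exp_pos y]

lemma sum_mul_sub_eq (F a : ℕ → ℂ) (n : ℕ) :
    ∑ i ∈ Finset.range n, F i * (a (i + 1) - a i) =
      F n * a n - F 0 * a 0 - ∑ i ∈ Finset.range n, a (i + 1) * (F (i + 1) - F i) := by
  induction n with
  | zero => simp
  | succ n ih => rw [Finset.sum_range_succ, Finset.sum_range_succ, ih]; ring

lemma ofReal_exp_cpow (r : ℝ) (s : ℂ) : ((Real.exp r : ℝ) : ℂ) ^ (-s) = Complex.exp (-s * r) := by
  rw [Complex.cpow_def_of_ne_zero (by exact_mod_cast (Real.exp_pos r).ne'),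
    ← Complex.ofReal_log (Real.exp_pos r).le, Real.log_exp]
  congr 1; ring

lemma integral_exp_deriv (s : ℂ) (x y : ℝ) :
    ∫ r in x..y, s * Complex.exp (-s * r) = -(Complex.exp (-s * y) - Complex.exp (-s * x)) := by
  have h : ∀ r ∈ uIcc x y, HasDerivAt (fun r : ℝ => -Complex.exp (-s * r))
      (s * Complex.exp (-s * r)) r := by
    intro r _
    have h1 : HasDerivAt (fun z : ℂ => -Complex.exp (-s * z)) (s * Complex.exp (-s * r)) (r : ℂ) := by
      have h2 : HasDerivAt (fun z : ℂ => -s * z) (-s) (r : ℂ) := by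
        simpa using (hasDerivAt_id (r : ℂ)).const_mul (-s)
      rw [show s * Complex.exp (-s * r) = -(Complex.exp (-s * r) * -s) by ring]
      exact h2.cexp.neg
    exact h1.comp_ofReal
  rw [intervalIntegral.integral_eq_sub_of_hasDerivAt h
    (Continuous.intervalIntegrable (by fun_prop) _ _)]
  ring

lemma MonotoneSub.intervalIntegrable {P Q A : ℝ → ℝ} (hP : Monotone P) (hQ : Monotone Q)
    (hA : A = P - Q) (x y : ℝ) :
    IntervalIntegrable (fun r => (A (Real.exp r) : ℂ)) volume x y := by
  have h1 : IntervalIntegrable (fun r => P (Real.exp r)) volume x y :=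
    (hP.comp Real.exp_monotone).intervalIntegrable
  have h2 : IntervalIntegrable (fun r => Q (Real.exp r)) volume x y :=
    (hQ.comp Real.exp_monotone).intervalIntegrable
  have h3 := h1.sub h2
  subst hA
  refine (⟨h3.1.ofReal, h3.2.ofReal⟩ : IntervalIntegrable (fun r => ((P (Real.exp r) -
    Q (Real.exp r) : ℝ) : ℂ)) volume x y)

/-- Partial integration in the Riemann-Stieltjes integral of `x^{-s}`. -/
lemma HasStieltjesIntegral.eq_parts {P Q A : ℝ → ℝ} (hP : Monotone P) (hQ : Monotone Q)
    (hA : A = P - Q) {s I : ℂ} {t : ℝ} (ht : 0 ≤ t)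
    (hI : HasStieltjesIntegral (fun x => (x : ℂ) ^ (-s)) A 1 (Real.exp t) I) :
    I = Complex.exp (-s * t) * A (Real.exp t) - A 1 +
      ∫ r in (0 : ℝ)..t, (A (Real.exp r) : ℂ) * (s * Complex.exp (-s * r)) := by
  set a : ℝ → ℝ := fun r => A (Real.exp r) with ha
  set W : ℝ → ℝ := fun r => P (Real.exp r) + Q (Real.exp r) with hW
  have hWmono : Monotone W := (hP.comp Real.exp_monotone).add (hQ.comp Real.exp_monotone)
  have haW : ∀ x y, x ≤ y → |a y - a x| ≤ W y - W x := by
    intro x y hxy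
    have h1 := hP (Real.exp_monotone hxy)
    have h2 := hQ (Real.exp_monotone hxy)
    simp only [ha, hW, hA, Pi.sub_apply]
    rw [abs_le]; constructor <;> linarith
  have hint : ∀ x y : ℝ, IntervalIntegrable
      (fun r : ℝ => (a r : ℂ) * (s * Complex.exp (-s * r))) volume x y := fun x y =>
    (MonotoneSub.intervalIntegrable hP hQ hA x y).mul_continuousOn
      (Continuous.continuousOn (by fun_prop))
  set Z : ℂ := Complex.exp (-s * t) * a t - A 1 +
      ∫ r in (0 : ℝ)..t, (a r : ℂ) * (s * Complex.exp (-s * r)) with hZ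
  change I = Z
  set D : ℝ := ‖s‖ * Real.exp (‖s‖ * t) with hD
  have hD0 : 0 ≤ D := by positivity
  have hFD : ∀ r ∈ Icc 0 t, ‖s * Complex.exp (-s * r)‖ ≤ D := by
    intro r hr
    rw [norm_mul]
    refine mul_le_mul_of_nonneg_left ?_ (norm_nonneg _)
    refine (Complex.norm_exp_le_exp_norm _).trans (Real.exp_le_exp.2 ?_)
    rw [norm_mul, norm_neg, Complex.norm_real, Real.norm_of_nonneg hr.1]
    exact mul_le_mul_of_nonneg_left hr.2 (norm_nonneg _)
  refine eq_of_forall_dist_le fun ε hε => ?_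
  obtain ⟨δ, hδ, hsum⟩ := hI (ε / 2) (by positivity)
  -- The second summand makes the mesh less than δ, the third makes the partial-integration error at
  -- most ε/2.
  obtain ⟨n, hn⟩ := exists_nat_gt
    (1 + Real.exp t * t / δ + (W t - W 0) * D * t / (ε / 2))
  have hWt : 0 ≤ W t - W 0 := sub_nonneg.2 (hWmono ht)
  have hn0 : (0 : ℝ) < n := by
    have : 0 ≤ Real.exp t * t / δ + (W t - W 0) * D * t / (ε / 2) := by positivity
    linarith
  have hn1 : Real.exp t * (t / n) < δ := by
    have : 0 ≤ (W t - W 0) * D * t / (ε / 2) := by positivity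
    have h : Real.exp t * t / δ < n := by linarith
    rw [div_lt_iff₀ hδ] at h
    rw [← mul_div_assoc, div_lt_iff₀ hn0]; linarith
  have hn2 : (W t - W 0) * (D * (t / n)) ≤ ε / 2 := by
    have : 0 ≤ Real.exp t * t / δ := by positivity
    have h : (W t - W 0) * D * t / (ε / 2) < n := by linarith
    rw [div_lt_iff₀ (by positivity)] at h
    rw [← mul_assoc, ← mul_div_assoc, div_le_iff₀ hn0]; linarith
  -- The partition of [1, e^t] is geometric, hence uniform after taking logarithms, and is tagged at
  -- left endpoints.
  set q : ℕ → ℝ := fun i => i * (t / n) with hq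
  have hq0 : q 0 = 0 := by simp [hq]
  have hqn : q n = t := by simp only [hq]; field_simp
  have hqs : ∀ i, q (i + 1) - q i = t / n := by intro i; simp only [hq]; push_cast; ring
  have htn : 0 ≤ t / n := by positivity
  have hqm : ∀ i, q i ≤ q (i + 1) := fun i => by linarith [hqs i]
  have hqt : ∀ i < n, q (i + 1) ≤ t := by
    intro i hi
    rw [← hqn]
    simp only [hq]
    exact mul_le_mul_of_nonneg_right (by exact_mod_cast hi) htn
  have hqnn : ∀ i, 0 ≤ q i := fun i => by simp only [hq]; positivity
  have h1 := hsum n (fun i => Real.exp (q i)) (fun i => Real.exp (q i)) (by simp [hq0])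
    (by simp [hqn]) (fun i hi => ⟨le_rfl, Real.exp_monotone (hqm i), by
      refine (exp_sub_exp_le _ _).trans_lt ?_
      rw [hqs]
      exact (mul_le_mul_of_nonneg_right (Real.exp_monotone (hqt i hi)) htn).trans_lt hn1⟩)
  -- Abel summation writes the discrepancy as an integral of increments of A over single cells. They
  -- are bounded by the increments of W = P + Q, which telescope, so no continuity of A is needed.
  have hS : (∑ i ∈ Finset.range n, ((Real.exp (q i) : ℝ) : ℂ) ^ (-s) *
      ((A (Real.exp (q (i + 1))) - A (Real.exp (q i)) : ℝ) : ℂ)) - Z =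
      ∑ i ∈ Finset.range n, ∫ r in (q i)..(q (i + 1)),
        ((a (q (i + 1)) : ℂ) - a r) * (s * Complex.exp (-s * r)) := by
    have e1 : ∀ i, ((Real.exp (q i) : ℝ) : ℂ) ^ (-s) *
      ((A (Real.exp (q (i + 1))) - A (Real.exp (q i)) : ℝ) : ℂ) =
        Complex.exp (-s * q i) * ((a (q (i + 1)) : ℂ) - (a (q i) : ℂ)) := by
      intro i; rw [ofReal_exp_cpow]; push_cast; rfl
    have e2 : ∀ i, ∫ r in (q i)..(q (i + 1)),
        ((a (q (i + 1)) : ℂ) - a r) * (s * Complex.exp (-s * r)) =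
        -((a (q (i + 1)) : ℂ) * (Complex.exp (-s * q (i + 1)) - Complex.exp (-s * q i))) -
        ∫ r in (q i)..(q (i + 1)), (a r : ℂ) * (s * Complex.exp (-s * r)) := by
      intro i
      simp_rw [sub_mul]
      rw [intervalIntegral.integral_sub (Continuous.intervalIntegrable (by fun_prop) _ _)
        (hint _ _), intervalIntegral.integral_const_mul, integral_exp_deriv]
      ring
    simp_rw [e1, e2]
    rw [sum_mul_sub_eq (fun i => Complex.exp (-s * q i)) (fun i => (a (q i) : ℂ)),
      Finset.sum_sub_distrib, intervalIntegral.sum_integral_adjacent_intervals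
        (fun i _ => hint _ _), Finset.sum_neg_distrib, hqn, hq0, hZ]
    have : a 0 = A 1 := by simp [ha]
    rw [this]
    simp
    ring
  have h2 : ‖∑ i ∈ Finset.range n, ∫ r in (q i)..(q (i + 1)),
        ((a (q (i + 1)) : ℂ) - a r) * (s * Complex.exp (-s * r))‖ ≤ ε / 2 := by
    refine (norm_sum_le _ _).trans ?_
    have h3 : ∀ i ∈ Finset.range n, ‖∫ r in (q i)..(q (i + 1)),
        ((a (q (i + 1)) : ℂ) - a r) * (s * Complex.exp (-s * r))‖ ≤
        (W (q (i + 1)) - W (q i)) * (D * (t / n)) := by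
      intro i hi
      rw [Finset.mem_range] at hi
      have := intervalIntegral.norm_integral_le_of_norm_le_const (a := q i) (b := q (i + 1))
        (f := fun r : ℝ => ((a (q (i + 1)) : ℂ) - a r) * (s * Complex.exp (-s * r)))
        (C := (W (q (i + 1)) - W (q i)) * D) (fun r hr => by
          rw [uIoc_of_le (hqm i)] at hr
          rw [norm_mul]
          refine mul_le_mul ?_ (hFD r ⟨(hqnn i).trans hr.1.le, hr.2.trans (hqt i hi)⟩)
            (norm_nonneg _) (sub_nonneg.2 (hWmono (hqm i)))
          rw [← Complex.ofReal_sub, Complex.norm_real, Real.norm_eq_abs]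
          exact (haW _ _ hr.2).trans (by linarith [hWmono hr.1.le]))
      rw [hqs, abs_of_nonneg htn] at this
      rwa [mul_assoc] at this
    refine (Finset.sum_le_sum h3).trans ?_
    rw [← Finset.sum_mul, Finset.sum_range_sub (fun i => W (q i)), hqn, hq0]
    exact hn2
  rw [← hS] at h2
  rw [dist_eq_norm]
  have h4 : I - Z = -((∑ i ∈ Finset.range n, ((Real.exp (q i) : ℝ) : ℂ) ^ (-s) *
      ((A (Real.exp (q (i + 1))) - A (Real.exp (q i)) : ℝ) : ℂ)) - I) +
      ((∑ i ∈ Finset.range n, ((Real.exp (q i) : ℝ) : ℂ) ^ (-s) *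
      ((A (Real.exp (q (i + 1))) - A (Real.exp (q i)) : ℝ) : ℂ)) - Z) := by ring
  rw [h4]
  refine (norm_add_le _ _).trans ?_
  rw [norm_neg]
  linarith

/-! ### Growth of A(x)/x and its Laplace transform -/

/-- The function `A(x) / x` on the logarithmic scale. -/
def logDensity (A : ℝ → ℝ) (t : ℝ) : ℝ := A (Real.exp t) / Real.exp t

lemma measurable_of_locallyBoundedVariation {A : ℝ → ℝ}
    (hA : LocallyBoundedVariationOn A univ) : Measurable A := by
  obtain ⟨P, Q, hP, hQ, rfl⟩ := hA.exists_monotoneOn_sub_monotoneOn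
  exact (monotoneOn_univ.1 hP).measurable.sub (monotoneOn_univ.1 hQ).measurable

lemma measurable_logDensity {A : ℝ → ℝ} (hA : LocallyBoundedVariationOn A univ) :
    Measurable (logDensity A) :=
  ((measurable_of_locallyBoundedVariation hA).comp Real.measurable_exp).div Real.measurable_exp

lemma logDensity_mul_exp (A : ℝ → ℝ) (s : ℂ) (t : ℝ) :
    (A (Real.exp t) : ℂ) * Complex.exp (-(s + 1) * t) =
      (logDensity A t : ℂ) * Complex.exp (-s * t) := by
  unfold logDensity
  have : Complex.exp (-(s + 1) * t) = Complex.exp (-s * t) * (Complex.exp t)⁻¹ := by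
    rw [← Complex.exp_neg, ← Complex.exp_add]; congr 1; ring
  rw [this]; push_cast; ring

lemma intervalIntegrable_logDensity_mul {A : ℝ → ℝ} (hA : LocallyBoundedVariationOn A univ)
    (s : ℂ) (x y : ℝ) :
    IntervalIntegrable (fun r : ℝ => (logDensity A r : ℂ) * Complex.exp (-s * r)) volume x y := by
  obtain ⟨P, Q, hP, hQ, h⟩ := hA.exists_monotoneOn_sub_monotoneOn
  have := (MonotoneSub.intervalIntegrable (monotoneOn_univ.1 hP) (monotoneOn_univ.1 hQ) h
    x y).mul_continuousOn (g := fun r : ℝ => Complex.exp (-(s + 1) * r))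
      (Continuous.continuousOn (by fun_prop))
  simpa only [logDensity_mul_exp] using this

/-- Partial integration with X = e^t; dividing A by e^t lowers the exponent from s + 1 to s, and the
jump A(1) cancels the boundary term at 1. -/
lemma HasMellinStieltjes.tendsto_log {A : ℝ → ℝ} (hA : LocallyBoundedVariationOn A univ)
    {s w : ℂ} (h : HasMellinStieltjes A (s + 1) w) :
    Tendsto (fun t : ℝ => (logDensity A t : ℂ) * Complex.exp (-s * t) +
      (s + 1) * ∫ r in (0 : ℝ)..t, (logDensity A r : ℂ) * Complex.exp (-s * r)) atTop (𝓝 w) := by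
  obtain ⟨P, Q, hP, hQ, hPQ⟩ := hA.exists_monotoneOn_sub_monotoneOn
  obtain ⟨I, hI, hlim⟩ := h
  refine (hlim.comp Real.tendsto_exp_atTop).congr' ?_
  filter_upwards [eventually_ge_atTop 0] with t ht
  have h1 := (hI (Real.exp t) (Real.one_le_exp ht)).eq_parts (monotoneOn_univ.1 hP)
    (monotoneOn_univ.1 hQ) hPQ ht
  simp only [Function.comp_apply]
  rw [h1, ← logDensity_mul_exp, ← intervalIntegral.integral_const_mul]
  have : ∀ r : ℝ, (A (Real.exp r) : ℂ) * ((s + 1) * Complex.exp (-(s + 1) * r)) =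
      (s + 1) * ((logDensity A r : ℂ) * Complex.exp (-s * r)) := by
    intro r; rw [← logDensity_mul_exp]; ring
  simp_rw [this]
  ring

lemma exists_abs_logDensity_le_of_le {A : ℝ → ℝ} (hA : LocallyBoundedVariationOn A univ) (t₀ : ℝ) :
    ∃ C, ∀ t, 0 ≤ t → t ≤ t₀ → |logDensity A t| ≤ C := by
  obtain ⟨P, Q, hP, hQ, h⟩ := hA.exists_monotoneOn_sub_monotoneOn
  rw [monotoneOn_univ] at hP hQ
  refine ⟨|P 1| + |P (Real.exp t₀)| + (|Q 1| + |Q (Real.exp t₀)|), fun t h0 h1 => ?_⟩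
  have h2 : |A (Real.exp t)| ≤ |P (Real.exp t)| + |Q (Real.exp t)| := by
    rw [h]; exact abs_sub _ _
  have h3 : ∀ R : ℝ → ℝ, Monotone R → |R (Real.exp t)| ≤ |R 1| + |R (Real.exp t₀)| := by
    intro R hR
    have h4 := hR (Real.one_le_exp h0)
    have h5 := hR (Real.exp_monotone h1)
    rw [abs_le]
    constructor
    · linarith [neg_abs_le (R 1), abs_nonneg (R (Real.exp t₀))]
    · linarith [le_abs_self (R (Real.exp t₀)), abs_nonneg (R 1)]
  have h6 : |logDensity A t| ≤ |A (Real.exp t)| := by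
    unfold logDensity
    rw [abs_div, abs_of_pos (Real.exp_pos t)]
    exact div_le_self (abs_nonneg _) (Real.one_le_exp h0)
  linarith [h3 P hP, h3 Q hQ]

lemma le_two_div_mul_exp {ε : ℝ} (hε : 0 < ε) (t : ℝ) : t ≤ 2 / ε * Real.exp (ε / 2 * t) := by
  have h := Real.add_one_le_exp (ε / 2 * t)
  rw [div_mul_eq_mul_div, le_div_iff₀ hε]
  linarith

lemma integral_exp_neg_mul_le {a t : ℝ} (ha : 0 < a) :
    ∫ r in (0 : ℝ)..t, Real.exp (-(a * r)) ≤ 1 / a := by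
  have h : ∀ r ∈ uIcc 0 t, HasDerivAt (fun r : ℝ => -(Real.exp (-(a * r)) / a))
      (Real.exp (-(a * r))) r := by
    intro r _
    have h2 : HasDerivAt (fun r : ℝ => -(a * r)) (-a) r := by
      simpa only [neg_mul, id_eq, mul_one] using (hasDerivAt_id r).const_mul (-a)
    have h3 := (h2.exp.div_const a).neg
    have e : Real.exp (-(a * r)) = -(Real.exp (-(a * r)) * -a / a) := by field_simp
    rw [e]
    exact h3
  rw [intervalIntegral.integral_eq_sub_of_hasDerivAt h
    (Continuous.intervalIntegrable (by fun_prop) _ _)]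
  have : 0 ≤ Real.exp (-(a * t)) / a := by positivity
  simp only [mul_zero, neg_zero, Real.exp_zero]
  linarith

/-- Convergence of the Mellin-Stieltjes transform and controlled decrease bound the growth. -/
lemma exists_abs_logDensity_le_exp {A : ℝ → ℝ} (hA : LocallyBoundedVariationOn A univ)
    (hconv : ∀ s : ℂ, 1 < s.re → MellinStieltjesConverges A s) {M N : ℝ} (hM : 0 ≤ M) (hN : 0 ≤ N)
    (hlow : ∀ t, 0 ≤ t → -M - N * (1 + t) ≤ logDensity A t) {ε : ℝ} (hε : 0 < ε) :
    ∃ C, 0 ≤ C ∧ ∀ t, 0 ≤ t → |logDensity A t| ≤ C * Real.exp (ε * t) := by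
  obtain ⟨w, hw⟩ := hconv ((ε : ℂ) + 1) (by simp [hε])
  have hlim := hw.tendsto_log hA
  have hre := (Complex.continuous_re.tendsto w).comp hlim
  obtain ⟨t₀, ht₀⟩ := eventually_atTop.1 (hre.eventually (ge_mem_nhds (lt_add_one w.re)))
  obtain ⟨C₀, hC₀⟩ := exists_abs_logDensity_le_of_le hA t₀
  set c₁ := M + N + N * (2 / ε) with hc₁
  have hc₁0 : 0 ≤ c₁ := by positivity
  have hc : ∀ t, 0 ≤ t → M + N * (1 + t) ≤ c₁ * Real.exp (ε / 2 * t) := by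
    intro t ht
    have h1 := mul_le_mul_of_nonneg_left (le_two_div_mul_exp hε t) hN
    have h2 : 1 ≤ Real.exp (ε / 2 * t) := Real.one_le_exp (by positivity)
    have h3 := mul_le_mul_of_nonneg_left h2 (add_nonneg hM hN)
    rw [hc₁]; linarith
  have hexp : ∀ r : ℝ, Complex.exp (-(ε : ℂ) * r) = ((Real.exp (-(ε * r)) : ℝ) : ℂ) := by
    intro r; push_cast; congr 1; ring
  -- Convergence at the real point 1 + ε bounds a sum of h(t)e^{-εt} and an integral. One-sided
  -- control bounds the integral from below, hence h(t)e^{-εt} from above.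
  have hJ : ∀ t, t₀ ≤ t → logDensity A t * Real.exp (-(ε * t)) +
      (ε + 1) * ∫ r in (0 : ℝ)..t, logDensity A r * Real.exp (-(ε * r)) ≤ w.re + 1 := by
    intro t ht
    have h1 := ht₀ t ht
    simp only [Function.comp_apply, hexp, ← Complex.ofReal_mul, intervalIntegral.integral_ofReal]
      at h1
    have h2 : ((ε : ℂ) + 1) = ((ε + 1 : ℝ) : ℂ) := by push_cast; ring
    rw [h2, ← Complex.ofReal_mul, ← Complex.ofReal_add, Complex.ofReal_re] at h1
    exact h1
  have hint : ∀ x y : ℝ, IntervalIntegrable (fun r => logDensity A r * Real.exp (-(ε * r)))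
      volume x y := by
    intro x y
    have h := intervalIntegrable_logDensity_mul hA ε x y
    simp only [hexp, ← Complex.ofReal_mul] at h
    exact ⟨h.1.re, h.2.re⟩
  have hI : ∀ t, 0 ≤ t → -(c₁ * (2 / ε)) ≤
      ∫ r in (0 : ℝ)..t, logDensity A r * Real.exp (-(ε * r)) := by
    intro t ht
    have h1 : ∫ r in (0 : ℝ)..t, -c₁ * Real.exp (-(ε / 2 * r)) ≤
        ∫ r in (0 : ℝ)..t, logDensity A r * Real.exp (-(ε * r)) := by
      refine intervalIntegral.integral_mono_on ht
        (Continuous.intervalIntegrable (by fun_prop) _ _) (hint _ _) fun r hr => ?_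
      have h2 : -(c₁ * Real.exp (ε / 2 * r)) ≤ logDensity A r := by
        linarith [hc r hr.1, hlow r hr.1]
      have h3 := mul_le_mul_of_nonneg_right h2 (Real.exp_pos (-(ε * r))).le
      have h4 : Real.exp (-(ε / 2 * r)) = Real.exp (ε / 2 * r) * Real.exp (-(ε * r)) := by
        rw [← Real.exp_add]; congr 1; ring
      rw [h4]; linarith
    rw [intervalIntegral.integral_const_mul] at h1
    have h2 := mul_le_mul_of_nonneg_left (integral_exp_neg_mul_le (t := t) (half_pos hε)) hc₁0
    have h3 : 1 / (ε / 2) = 2 / ε := by field_simp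
    rw [h3] at h2
    linarith
  refine ⟨|C₀| + c₁ + |w.re| + 1 + (ε + 1) * (c₁ * (2 / ε)), by positivity, fun t ht => ?_⟩
  have he : 1 ≤ Real.exp (ε * t) := Real.one_le_exp (by positivity)
  have hK : 0 ≤ (ε + 1) * (c₁ * (2 / ε)) := by positivity
  rcases le_total t t₀ with h | h
  · have h1 := (hC₀ t ht h).trans (le_abs_self C₀)
    refine h1.trans ((?_ : |C₀| ≤ _).trans (le_mul_of_one_le_right (by positivity) he))
    linarith [abs_nonneg w.re]
  · rw [abs_le]
    constructor
    · have h1 := hlow t ht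
      have h2 := hc t ht
      have h3 : Real.exp (ε / 2 * t) ≤ Real.exp (ε * t) :=
        Real.exp_le_exp.2 (by nlinarith [mul_nonneg hε.le ht])
      have h4 := mul_le_mul_of_nonneg_left h3 hc₁0
      have h5 : 0 ≤ (|C₀| + |w.re| + 1 + (ε + 1) * (c₁ * (2 / ε))) * Real.exp (ε * t) := by
        positivity
      linarith
    · have h1 := hJ t h
      have h2 := mul_le_mul_of_nonneg_left (hI t ht) (by linarith : 0 ≤ ε + 1)
      have h3 : logDensity A t * Real.exp (-(ε * t)) ≤
          |C₀| + c₁ + |w.re| + 1 + (ε + 1) * (c₁ * (2 / ε)) := by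
        linarith [le_abs_self w.re, abs_nonneg C₀]
      rw [Real.exp_neg, ← div_eq_mul_inv, div_le_iff₀ (Real.exp_pos _)] at h3
      exact h3

lemma norm_exp_neg_mul_ofReal (s : ℂ) (t : ℝ) :
    ‖Complex.exp (-s * t)‖ = Real.exp (-(s.re * t)) := by
  rw [Complex.norm_exp]; congr 1; simp

lemma integrableOn_mul_exp_of_growth {f : ℝ → ℝ} (hf : Measurable f)
    (hgrow : ∀ ε : ℝ, 0 < ε → ∃ C, 0 ≤ C ∧ ∀ t, 0 ≤ t → |f t| ≤ C * Real.exp (ε * t))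
    {s : ℂ} (hs : 0 < s.re) :
    IntegrableOn (fun t : ℝ => (f t : ℂ) * Complex.exp (-s * t)) (Ioi 0) := by
  obtain ⟨C, hC0, hC⟩ := hgrow (s.re / 2) (half_pos hs)
  have h1 : IntegrableOn (fun t : ℝ => C * Real.exp (-(s.re / 2) * t)) (Ioi 0) :=
    (exp_neg_integrableOn_Ioi 0 (half_pos hs)).const_mul C
  refine h1.mono' ?_ ?_
  · exact ((Complex.measurable_ofReal.comp hf).mul
      (Continuous.measurable (by fun_prop))).aestronglyMeasurable
  · filter_upwards [ae_restrict_mem measurableSet_Ioi] with t ht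
    rw [norm_mul, Complex.norm_real, norm_exp_neg_mul_ofReal, Real.norm_eq_abs]
    have h2 := mul_le_mul_of_nonneg_right (hC t (le_of_lt ht)) (Real.exp_pos (-(s.re * t))).le
    refine h2.trans (le_of_eq ?_)
    rw [mul_assoc, ← Real.exp_add]; congr 2; ring

/-- The Mellin-Stieltjes transform as a Laplace transform on the logarithmic scale. -/
lemma mellinStieltjes_eq_laplace {A : ℝ → ℝ} (hA : LocallyBoundedVariationOn A univ)
    (hconv : ∀ s : ℂ, 1 < s.re → MellinStieltjesConverges A s)
    (hgrow : ∀ ε : ℝ, 0 < ε → ∃ C, 0 ≤ C ∧ ∀ t, 0 ≤ t → |logDensity A t| ≤ C * Real.exp (ε * t))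
    {s : ℂ} (hs : 0 < s.re) :
    1 / (s + 1) * mellinStieltjes A (s + 1) =
      ∫ t in Ioi (0 : ℝ), (logDensity A t : ℂ) * Complex.exp (-s * t) := by
  have hc := hconv (s + 1) (by simpa using hs)
  have hw : HasMellinStieltjes A (s + 1) (mellinStieltjes A (s + 1)) := by
    unfold mellinStieltjes
    rw [dif_pos hc]
    exact hc.choose_spec
  have hlim := hw.tendsto_log hA
  have hint := integrableOn_mul_exp_of_growth (measurable_logDensity hA) hgrow hs
  have h1 := intervalIntegral_tendsto_integral_Ioi 0 hint tendsto_id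
  have h2 : Tendsto (fun t : ℝ => (logDensity A t : ℂ) * Complex.exp (-s * t)) atTop (𝓝 0) := by
    obtain ⟨C, hC0, hC⟩ := hgrow (s.re / 2) (half_pos hs)
    have h3 : Tendsto (fun t : ℝ => C * Real.exp (-(s.re / 2 * t))) atTop (𝓝 (C * 0)) :=
      (Real.tendsto_exp_neg_atTop_nhds_zero.comp
        (tendsto_id.const_mul_atTop (half_pos hs))).const_mul C
    rw [mul_zero] at h3
    refine squeeze_zero_norm' ?_ h3
    filter_upwards [eventually_ge_atTop 0] with t ht
    rw [norm_mul, Complex.norm_real, norm_exp_neg_mul_ofReal, Real.norm_eq_abs]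
    have h2 := mul_le_mul_of_nonneg_right (hC t ht) (Real.exp_pos (-(s.re * t))).le
    refine h2.trans (le_of_eq ?_)
    rw [mul_assoc, ← Real.exp_add]; congr 2; ring
  -- `mellinStieltjes` is a chosen limit; uniqueness of limits identifies it with (s + 1) times the
  -- Laplace integral.
  have h3 := tendsto_nhds_unique hlim (h2.add (h1.const_mul (s + 1)))
  have hs1 : s + 1 ≠ 0 := by
    intro h
    have := congrArg Complex.re h
    simp at this
    linarith
  rw [h3, zero_add, ← mul_assoc, one_div_mul_cancel hs1, one_mul]

/-! ### Laplace transforms of normalized powers -/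

/-- The normalized power `t^ω / Γ(ω + 1)`. -/
def gammaPow (ω t : ℝ) : ℝ := t ^ ω / Real.Gamma (ω + 1)

section gammaPow

variable {ω t : ℝ}

lemma gammaPow_nonneg (hω : -1 < ω) (ht : 0 ≤ t) : 0 ≤ gammaPow ω t :=
  div_nonneg (Real.rpow_nonneg ht _) (Real.Gamma_pos_of_pos (by linarith)).le

lemma measurable_gammaPow (ω : ℝ) : Measurable (gammaPow ω) :=
  (measurable_id.pow_const ω).div_const _

lemma integrableOn_gammaPow_mul_exp (hω : -1 < ω) {p : ℂ} (hp : 0 < p.re) :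
    IntegrableOn (fun t : ℝ => (gammaPow ω t : ℂ) * Complex.exp (-p * t)) (Ioi 0) := by
  have h := (integrableOn_rpow_mul_exp_neg_mul_rpow hω one_pos hp).div_const (Real.Gamma (ω + 1))
  refine h.mono' ?_ ?_
  · exact ((Complex.measurable_ofReal.comp (measurable_gammaPow ω)).mul
      (Continuous.measurable (by fun_prop))).aestronglyMeasurable
  · filter_upwards [ae_restrict_mem measurableSet_Ioi] with t ht
    rw [norm_mul, Complex.norm_real, norm_exp_neg_mul_ofReal, Real.norm_of_nonneg
      (gammaPow_nonneg hω (le_of_lt ht)), gammaPow, Real.rpow_one]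
    refine le_of_eq ?_
    rw [neg_mul]; ring

lemma differentiableAt_laplace_gammaPow (hω : -1 < ω) {p : ℂ} (hp : 0 < p.re) :
    DifferentiableAt ℂ (fun p : ℂ => ∫ t in Ioi (0 : ℝ),
      (gammaPow ω t : ℂ) * Complex.exp (-p * t)) p := by
  have hb := (integrableOn_rpow_mul_exp_neg_mul_rpow (by linarith : -1 < ω + 1) one_pos
    (half_pos hp)).div_const (Real.Gamma (ω + 1))
  have hs : {z : ℂ | p.re / 2 < z.re} ∈ 𝓝 p :=
    (isOpen_lt continuous_const Complex.continuous_re).mem_nhds (by simp; linarith)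
  refine (hasDerivAt_integral_of_dominated_loc_of_deriv_le (μ := volume.restrict (Ioi (0 : ℝ)))
    (F := fun (p : ℂ) (t : ℝ) => (gammaPow ω t : ℂ) * Complex.exp (-p * t))
    (F' := fun (p : ℂ) (t : ℝ) => (gammaPow ω t : ℂ) * (Complex.exp (-p * t) * -t)) hs ?_
    (integrableOn_gammaPow_mul_exp hω hp) ?_ ?_ hb ?_).2.differentiableAt
  · filter_upwards with z
    exact ((Complex.measurable_ofReal.comp (measurable_gammaPow ω)).mul
      (Continuous.measurable (by fun_prop))).aestronglyMeasurable
  · exact ((Complex.measurable_ofReal.comp (measurable_gammaPow ω)).mul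
      (Continuous.measurable (by fun_prop))).aestronglyMeasurable
  · filter_upwards [ae_restrict_mem measurableSet_Ioi] with t ht z hz
    have ht' : 0 < t := ht
    rw [norm_mul, norm_mul, norm_neg, Complex.norm_real, Complex.norm_real,
      norm_exp_neg_mul_ofReal, Real.norm_of_nonneg (gammaPow_nonneg hω ht'.le),
      Real.norm_of_nonneg ht'.le, gammaPow, Real.rpow_add_one ht'.ne', Real.rpow_one]
    have h1 : Real.exp (-(z.re * t)) ≤ Real.exp (-(p.re / 2) * t) :=
      Real.exp_le_exp.2 (by
        have : p.re / 2 * t ≤ z.re * t := mul_le_mul_of_nonneg_right (le_of_lt hz) ht'.le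
        linarith)
    have h2 : 0 ≤ t ^ ω * t / Real.Gamma (ω + 1) :=
      div_nonneg (by positivity) (Real.Gamma_pos_of_pos (by linarith)).le
    have h3 := mul_le_mul_of_nonneg_left h1 h2
    refine le_trans (le_of_eq ?_) (h3.trans (le_of_eq ?_)) <;> ring
  · filter_upwards with t z _
    have h2 : HasDerivAt (fun z : ℂ => -z * t) (-t) z := by
      simpa using (hasDerivAt_id z).neg.mul_const (t : ℂ)
    exact h2.cexp.const_mul _

/-- The Laplace transform of `t^ω / Γ(ω + 1)`. -/
lemma laplace_gammaPow (hω : -1 < ω) {p : ℂ} (hp : 0 < p.re) :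
    ∫ t in Ioi (0 : ℝ), (gammaPow ω t : ℂ) * Complex.exp (-p * t) =
      1 / p ^ ((ω : ℂ) + 1) := by
  set U : Set ℂ := {z | 0 < z.re}
  have hU : IsOpen U := isOpen_lt continuous_const Complex.continuous_re
  have hf : AnalyticOnNhd ℂ (fun p : ℂ => ∫ t in Ioi (0 : ℝ),
      (gammaPow ω t : ℂ) * Complex.exp (-p * t)) U :=
    DifferentiableOn.analyticOnNhd
      (fun z hz => (differentiableAt_laplace_gammaPow hω hz).differentiableWithinAt) hU
  have hne : ∀ z ∈ U, z ≠ 0 := fun z hz h => by simp [U, h] at hz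
  have hg : AnalyticOnNhd ℂ (fun p : ℂ => 1 / p ^ ((ω : ℂ) + 1)) U := by
    refine DifferentiableOn.analyticOnNhd (fun z hz => ?_) hU
    refine DifferentiableAt.differentiableWithinAt ?_
    refine DifferentiableAt.div (differentiableAt_const _) ?_ ?_
    · exact differentiableAt_id.cpow (differentiableAt_const _) (Or.inl hz)
    · simp [Complex.cpow_eq_zero_iff, hne z hz]
  have hconv : IsPreconnected U :=
    (convex_halfSpace_re_gt 0).isPreconnected
  -- The Gamma integral gives the formula on the positive real axis; the identity theorem extends
  -- it, using real points accumulating at 1.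
  have hreal : ∀ r : ℝ, 0 < r → ∫ t in Ioi (0 : ℝ),
      (gammaPow ω t : ℂ) * Complex.exp (-(r : ℂ) * t) = 1 / (r : ℂ) ^ ((ω : ℂ) + 1) := by
    intro r hr
    have h1 := Complex.integral_cpow_mul_exp_neg_mul_Ioi (a := (ω : ℂ) + 1) (r := r)
      (by simp; linarith) hr
    have hG : Complex.Gamma ((ω : ℂ) + 1) = (Real.Gamma (ω + 1) : ℂ) := by
      rw [← Complex.Gamma_ofReal]; push_cast; rfl
    have hG0 : (Real.Gamma (ω + 1) : ℂ) ≠ 0 := by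
      exact_mod_cast (Real.Gamma_pos_of_pos (by linarith : 0 < ω + 1)).ne'
    have h2 : ∫ t in Ioi (0 : ℝ), (gammaPow ω t : ℂ) * Complex.exp (-(r : ℂ) * t) =
        ∫ t in Ioi (0 : ℝ), ((t : ℂ) ^ ((ω : ℂ) + 1 - 1) * Complex.exp (-(r * t))) /
          (Real.Gamma (ω + 1) : ℂ) := by
      refine setIntegral_congr_fun measurableSet_Ioi fun t ht => ?_
      simp only [gammaPow, add_sub_cancel_right]
      rw [← Complex.ofReal_cpow (le_of_lt ht)]
      push_cast
      rw [neg_mul]; ring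
    rw [h2, integral_div, h1, hG, mul_div_assoc, div_self hG0, mul_one, one_div, one_div,
      Complex.inv_cpow _ _ (by
        rw [Complex.arg_ofReal_of_nonneg hr.le]; exact Real.pi_pos.ne)]
  refine hf.eqOn_of_preconnected_of_frequently_eq hg hconv (z₀ := 1) (by simp [U]) ?_ hp
  have h3 : Tendsto (fun n : ℕ => ((1 + 1 / ((n : ℝ) + 1) : ℝ) : ℂ)) atTop (𝓝[≠] 1) := by
    refine tendsto_nhdsWithin_of_tendsto_nhds_of_eventually_within _ ?_ ?_
    · have := (tendsto_one_div_add_atTop_nhds_zero_nat (𝕜 := ℝ)).const_add 1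
      have h4 := (Complex.continuous_ofReal.tendsto _).comp this
      rw [add_zero, Complex.ofReal_one] at h4
      exact h4
    · filter_upwards with n
      simp only [mem_compl_iff, mem_singleton_iff]
      intro h
      have h5 : (1 + 1 / ((n : ℝ) + 1) : ℝ) = 1 := by exact_mod_cast h
      have : 0 < 1 / ((n : ℝ) + 1) := by positivity
      linarith
  refine h3.frequently (Frequently.of_forall fun n => ?_)
  exact hreal _ (by positivity)

end gammaPow

/-! ### Bounds for normalized powers, uniform in the exponent -/

section gammaPow

variable {ω t X : ℝ}

/-- On [s, ∞) the integrand e^{-x}x^ω of Γ(ω+1) is at least s^ω e^{-x}. This is the source of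
uniformity in ω. -/
lemma rpow_mul_exp_neg_le_Gamma (hω : 0 ≤ ω) {s : ℝ} (hs : 0 ≤ s) :
    s ^ ω * Real.exp (-s) ≤ Real.Gamma (ω + 1) := by
  have hc := Real.GammaIntegral_convergent (by linarith : 0 < ω + 1)
  rw [Real.Gamma_eq_integral (by linarith)]
  have h1 : ∫ x in Ioi s, Real.exp (-x) * x ^ (ω + 1 - 1) ≤
      ∫ x in Ioi (0 : ℝ), Real.exp (-x) * x ^ (ω + 1 - 1) := by
    refine setIntegral_mono_set hc ?_ (Ioi_subset_Ioi hs).eventuallyLE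
    filter_upwards [ae_restrict_mem measurableSet_Ioi] with x hx
    exact mul_nonneg (Real.exp_pos _).le (Real.rpow_nonneg (le_of_lt hx) _)
  refine le_trans ?_ h1
  have h2 : s ^ ω * Real.exp (-s) = ∫ x in Ioi s, s ^ ω * Real.exp (-x) := by
    rw [integral_const_mul, integral_exp_neg_Ioi]
  rw [h2]
  have hi : IntegrableOn (fun x : ℝ => s ^ ω * Real.exp (-x)) (Ioi s) := by
    have := exp_neg_integrableOn_Ioi s one_pos
    simp only [neg_mul, one_mul] at this
    exact this.const_mul _
  refine setIntegral_mono_on hi (hc.mono_set (Ioi_subset_Ioi hs)) measurableSet_Ioi fun x hx => ?_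
  rw [add_sub_cancel_right, mul_comm]
  exact mul_le_mul_of_nonneg_left (Real.rpow_le_rpow hs (le_of_lt hx) hω) (Real.exp_pos _).le

lemma one_third_le_Gamma (hω : 0 ≤ ω) : 1 / 3 ≤ Real.Gamma (ω + 1) := by
  refine le_trans ?_ (rpow_mul_exp_neg_le_Gamma hω zero_le_one)
  rw [Real.one_rpow, one_mul, Real.exp_neg, ← one_div]
  exact one_div_le_one_div_of_le (Real.exp_pos _) (by linarith [Real.exp_one_lt_d9])

/-- For -1 < ω < 0 use Γ(ω+1) = Γ(ω+2)/(ω+1) ≥ Γ(ω+2) ≥ 1/3. -/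
lemma one_div_Gamma_le (hω : -1 < ω) : 1 / Real.Gamma (ω + 1) ≤ 3 := by
  have hG := Real.Gamma_pos_of_pos (by linarith : 0 < ω + 1)
  rcases le_or_gt 0 ω with h | h
  · rw [div_le_iff₀ hG]
    linarith [one_third_le_Gamma h]
  · have h1 := one_third_le_Gamma (by linarith : 0 ≤ ω + 1)
    rw [Real.Gamma_add_one (by linarith)] at h1
    rw [div_le_iff₀ hG]
    nlinarith

lemma exp_mul_gammaPow_le_rpow (hX : 0 < X) (hω : 0 ≤ ω) (ht : 0 ≤ t) :
    Real.exp (-(t / X)) * gammaPow ω t ≤ X ^ ω := by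
  have h := rpow_mul_exp_neg_le_Gamma hω (div_nonneg ht hX.le)
  rw [Real.div_rpow ht hX.le] at h
  have hG := Real.Gamma_pos_of_pos (by linarith : 0 < ω + 1)
  unfold gammaPow
  rw [← mul_div_assoc, div_le_iff₀ hG]
  rw [div_mul_eq_mul_div, div_le_iff₀ (Real.rpow_pos_of_pos hX _)] at h
  linarith

lemma rpow_le_of_quarter_le {e : ℝ} (hX : 1 ≤ X) (he : e ≤ 0) (he2 : -2 ≤ e) (ht : X / 4 ≤ t) :
    t ^ e ≤ 16 := by
  have h1 : t ^ e ≤ (1 / 4 : ℝ) ^ e :=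
    Real.rpow_le_rpow_of_nonpos (by norm_num) (by linarith) he
  have h2 : (1 / 4 : ℝ) ^ e ≤ (1 / 4 : ℝ) ^ (-2 : ℝ) :=
    Real.rpow_le_rpow_of_exponent_ge (by norm_num) (by norm_num) he2
  refine (h1.trans h2).trans (le_of_eq ?_)
  rw [Real.rpow_neg (by norm_num), Real.rpow_two]
  norm_num

lemma exp_mul_gammaPow_le {Ω : ℝ} (hX : 1 ≤ X) (hω : -1 < ω) (hωΩ : ω ≤ Ω) (ht : X / 4 ≤ t) :
    Real.exp (-(t / X)) * gammaPow ω t ≤ 48 * X ^ (max Ω 0) := by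
  have ht0 : 0 ≤ t := by linarith
  have hQ : 1 ≤ X ^ (max Ω 0) := Real.one_le_rpow hX (le_max_right _ _)
  rcases le_or_gt 0 ω with h | h
  · have h1 := exp_mul_gammaPow_le_rpow (by linarith : 0 < X) h ht0
    have h2 := Real.rpow_le_rpow_of_exponent_le hX (hωΩ.trans (le_max_left Ω 0))
    linarith
  · have h1 := rpow_le_of_quarter_le hX h.le (by linarith) ht
    have h2 := one_div_Gamma_le hω
    have h3 : gammaPow ω t ≤ 16 * 3 := by
      unfold gammaPow
      rw [div_eq_mul_one_div]
      exact mul_le_mul h1 h2 (one_div_nonneg.2 (Real.Gamma_pos_of_pos (by linarith)).le)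
        (by norm_num)
    have h4 := mul_le_of_le_one_left (gammaPow_nonneg hω ht0)
      (exp_neg_div_le_one (by linarith : 0 < X) ht0)
    linarith

lemma expWeight_mul_gammaPow_le {Ω : ℝ} (hX : 1 ≤ X) (hω : -1 < ω) (hωΩ : ω ≤ Ω) (ht : 0 ≤ t) :
    expWeight X t * gammaPow ω t ≤ 48 * X ^ (max Ω 0) := by
  have hX0 : 0 < X := by linarith
  have hg := gammaPow_nonneg hω ht
  rcases le_or_gt (X / 4) t with h | h
  · exact (mul_le_mul_of_nonneg_right expWeight_le_exp hg).trans
      (exp_mul_gammaPow_le hX hω hωΩ h)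
  · have hQ : 1 ≤ X ^ (max Ω 0) := Real.one_le_rpow hX (le_max_right _ _)
    rcases ht.eq_or_lt with rfl | ht'
    · rw [expWeight_zero, zero_mul]; positivity
    rcases le_or_gt 0 ω with h' | h'
    · have h1 := exp_mul_gammaPow_le_rpow hX0 h' ht
      have h2 := Real.rpow_le_rpow_of_exponent_le hX (hωΩ.trans (le_max_left Ω 0))
      have h3 := mul_le_mul_of_nonneg_right (expWeight_le_exp (X := X) (t := t)) hg
      linarith
    -- For ω < 0 the linear zero of the weight at 0 cancels the singularity of t^ω. This covers t <
    -- X/4, where the plain exponential would not do.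
    · have hE : expWeight X t ≤ t / X := by
        rw [expWeight_eq]
        have h1 := Real.add_one_le_exp (-(t / X))
        have h2 := exp_neg_div_le_one hX0 ht
        have h3 := Real.exp_pos (-(t / X))
        nlinarith
      have h1 : expWeight X t * gammaPow ω t ≤ t / X * gammaPow ω t :=
        mul_le_mul_of_nonneg_right hE hg
      have h2 : t / X * gammaPow ω t = t ^ (ω + 1) / X * (1 / Real.Gamma (ω + 1)) := by
        unfold gammaPow; rw [Real.rpow_add_one ht'.ne']; ring
      have h3 : t ^ (ω + 1) / X ≤ 1 := by
        rw [div_le_one hX0]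
        have h4 : t ^ (ω + 1) ≤ X ^ (ω + 1) :=
          Real.rpow_le_rpow ht (by linarith) (by linarith)
        have h5 : X ^ (ω + 1) ≤ X ^ (1 : ℝ) :=
          Real.rpow_le_rpow_of_exponent_le hX (by linarith)
        rw [Real.rpow_one] at h5
        exact h4.trans h5
      have h4 := one_div_Gamma_le hω
      have h5 : t ^ (ω + 1) / X * (1 / Real.Gamma (ω + 1)) ≤ 1 * 3 :=
        mul_le_mul h3 h4 (one_div_nonneg.2 (Real.Gamma_pos_of_pos (by linarith)).le) zero_le_one
      linarith

lemma hasDerivAt_gammaPow (ht : 0 < t) :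
    HasDerivAt (gammaPow ω) (ω * t ^ (ω - 1) / Real.Gamma (ω + 1)) t :=
  (Real.hasDerivAt_rpow_const (Or.inl ht.ne')).div_const _

/-- For ω ≥ 1 the derivative is the normalized power of exponent ω - 1. Otherwise |ω| ≤ 1 and -2 < ω
- 1 < 0, so t ≥ X/4 ≥ 1/4 gives 16 · 3 = 48. -/
lemma exp_mul_abs_deriv_gammaPow_le {Ω : ℝ} (hX : 1 ≤ X) (hω : -1 < ω) (hωΩ : ω ≤ Ω)
    (ht : X / 4 ≤ t) :
    Real.exp (-(t / X)) * |ω * t ^ (ω - 1) / Real.Gamma (ω + 1)| ≤ 48 * X ^ (max Ω 0) := by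
  have ht0 : 0 ≤ t := by linarith
  have hX0 : 0 < X := by linarith
  have hQ : 1 ≤ X ^ (max Ω 0) := Real.one_le_rpow hX (le_max_right _ _)
  rcases le_or_gt 1 ω with h | h
  · have h1 : ω * t ^ (ω - 1) / Real.Gamma (ω + 1) = gammaPow (ω - 1) t := by
      unfold gammaPow
      rw [Real.Gamma_add_one (by linarith), sub_add_cancel, mul_div_mul_left _ _ (by linarith)]
    rw [h1, abs_of_nonneg (gammaPow_nonneg (by linarith) ht0)]
    have h2 := exp_mul_gammaPow_le_rpow hX0 (by linarith : 0 ≤ ω - 1) ht0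
    have h3 := Real.rpow_le_rpow_of_exponent_le hX
      ((by linarith : ω - 1 ≤ Ω).trans (le_max_left Ω 0))
    linarith
  · have h1 := rpow_le_of_quarter_le hX (by linarith : ω - 1 ≤ 0) (by linarith) ht
    have h2 := one_div_Gamma_le hω
    have hG := Real.Gamma_pos_of_pos (by linarith : 0 < ω + 1)
    have h3 : |ω * t ^ (ω - 1) / Real.Gamma (ω + 1)| ≤ 16 * 3 := by
      rw [mul_div_assoc, abs_mul, abs_of_nonneg (div_nonneg (Real.rpow_nonneg ht0 _) hG.le)]
      have h4 : |ω| ≤ 1 := abs_le.2 ⟨hω.le, h.le⟩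
      have h5 : t ^ (ω - 1) / Real.Gamma (ω + 1) ≤ 16 * 3 := by
        rw [div_eq_mul_one_div]
        exact mul_le_mul h1 h2 (one_div_nonneg.2 hG.le) (by norm_num)
      exact (mul_le_of_le_one_left (div_nonneg (Real.rpow_nonneg ht0 _) hG.le) h4).trans h5
    have h4 := mul_le_of_le_one_left (abs_nonneg (ω * t ^ (ω - 1) / Real.Gamma (ω + 1)))
      (exp_neg_div_le_one hX0 ht0)
    linarith

end gammaPow

/-! ### Oscillating main terms -/

/-- A single oscillating main term on the logarithmic scale. -/
def waveTerm (c : ℂ) (b ω t : ℝ) : ℝ :=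
  gammaPow ω t * (2 * (c * Complex.exp (-(Complex.I * (b : ℂ) * (t : ℂ)))).re)

section waveTerm

variable {c : ℂ} {b ω t s X Ω : ℝ}

lemma abs_two_re_le (c : ℂ) (b t : ℝ) :
    |2 * (c * Complex.exp (-(Complex.I * (b : ℂ) * (t : ℂ)))).re| ≤ 2 * ‖c‖ := by
  rw [abs_mul, abs_two]
  refine mul_le_mul_of_nonneg_left ((Complex.abs_re_le_norm _).trans ?_) zero_le_two
  rw [norm_mul, norm_exp_neg_I_mul, mul_one]

lemma abs_waveTerm_le (hω : -1 < ω) (ht : 0 ≤ t) : |waveTerm c b ω t| ≤ gammaPow ω t * (2 * ‖c‖) := by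
  unfold waveTerm
  rw [abs_mul, abs_of_nonneg (gammaPow_nonneg hω ht)]
  exact mul_le_mul_of_nonneg_left (abs_two_re_le c b t) (gammaPow_nonneg hω ht)

lemma expWeight_mul_abs_waveTerm_le (hX : 1 ≤ X) (hω : -1 < ω) (hωΩ : ω ≤ Ω) (ht : 0 ≤ t) :
    expWeight X t * |waveTerm c b ω t| ≤ 288 * ‖c‖ * (1 + |b|) * X ^ (max Ω 0) := by
  have h1 := mul_le_mul_of_nonneg_left (abs_waveTerm_le (c := c) (b := b) hω ht)
    (expWeight_nonneg (by linarith : 0 < X) ht)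
  have h2 := mul_le_mul_of_nonneg_right (expWeight_mul_gammaPow_le hX hω hωΩ ht)
    (by positivity : 0 ≤ 2 * ‖c‖)
  have h3 : 0 ≤ ‖c‖ * X ^ (max Ω 0) := by positivity
  have h4 : 0 ≤ ‖c‖ * |b| * X ^ (max Ω 0) := by positivity
  linarith

lemma hasDerivAt_waveTerm (ht : 0 < t) : HasDerivAt (waveTerm c b ω)
    (ω * t ^ (ω - 1) / Real.Gamma (ω + 1) *
      (2 * (c * Complex.exp (-(Complex.I * (b : ℂ) * (t : ℂ)))).re) +
    gammaPow ω t * (2 * ((-Complex.I * b * c) *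
      Complex.exp (-(Complex.I * (b : ℂ) * (t : ℂ)))).re)) t := by
  refine (hasDerivAt_gammaPow ht).mul ?_
  have h1 : HasDerivAt (fun z : ℂ => -(Complex.I * b * z)) (-(Complex.I * b)) (t : ℂ) := by
    simpa only [neg_mul, id_eq, mul_one] using
      (hasDerivAt_id (t : ℂ)).const_mul (-(Complex.I * b))
  have h2 := (h1.cexp.const_mul c).real_of_complex.const_mul 2
  rw [show -Complex.I * b * c * Complex.exp (-(Complex.I * (b : ℂ) * (t : ℂ))) =
    c * (Complex.exp (-(Complex.I * b * t)) * -(Complex.I * b)) by ring]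
  exact h2

/-- Mean value inequality: differentiating the oscillation costs |b|. Points between s and t are at
most t + X, so e^{r/X} ≤ e·e^{t/X} ≤ 3e^{t/X}, and the weight at t cancels e^{t/X}. -/
lemma expWeight_mul_abs_waveTerm_sub_le (hX : 1 ≤ X) (hω : -1 < ω) (hωΩ : ω ≤ Ω)
    (ht : X / 4 ≤ t) (hs : X / 4 ≤ s) (hts : |t - s| ≤ X) :
    expWeight X t * |waveTerm c b ω t - waveTerm c b ω s| ≤
      288 * ‖c‖ * (1 + |b|) * X ^ (max Ω 0) * |t - s| := by
  have hX0 : 0 < X := by linarith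
  set Q := X ^ (max Ω 0)
  have hQ : 0 < Q := Real.rpow_pos_of_pos hX0 _
  set D := 96 * ‖c‖ * (1 + |b|) * Q * (3 * Real.exp (t / X))
  have hder : ∀ r ∈ uIcc s t, HasDerivWithinAt (waveTerm c b ω) _ (uIcc s t) r := fun r hr =>
    (hasDerivAt_waveTerm (by
      have := (le_min hs ht).trans hr.1
      linarith)).hasDerivWithinAt
  have key := (convex_uIcc s t).norm_image_sub_le_of_norm_hasDerivWithin_le (C := D) hder
    (fun r hr => by
      have hr1 : X / 4 ≤ r := (le_min hs ht).trans hr.1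
      have hr2 : r / X ≤ t / X + 1 := by
        rw [← div_self hX0.ne', ← add_div]
        refine div_le_div_of_nonneg_right (hr.2.trans ?_) hX0.le
        rw [abs_le] at hts
        exact max_le (by linarith) (by linarith)
      have h0 : (0 : ℝ) ≤ Real.exp (r / X) := (Real.exp_pos _).le
      have e1 : Real.exp (r / X) * Real.exp (-(r / X)) = 1 := by
        rw [← Real.exp_add, add_neg_cancel, Real.exp_zero]
      have h1 : |ω * r ^ (ω - 1) / Real.Gamma (ω + 1)| ≤ 48 * Q * Real.exp (r / X) := by
        have := mul_le_mul_of_nonneg_left (exp_mul_abs_deriv_gammaPow_le hX hω hωΩ hr1) h0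
        rw [← mul_assoc, e1, one_mul] at this
        linarith
      have h2 : |gammaPow ω r| ≤ 48 * Q * Real.exp (r / X) := by
        have := mul_le_mul_of_nonneg_left (exp_mul_gammaPow_le hX hω hωΩ hr1) h0
        rw [← mul_assoc, e1, one_mul] at this
        rw [abs_of_nonneg (gammaPow_nonneg hω (by linarith))]
        linarith
      have h3 : Real.exp (r / X) ≤ 3 * Real.exp (t / X) := by
        refine (Real.exp_le_exp.2 hr2).trans ?_
        rw [Real.exp_add, mul_comm]
        exact mul_le_mul_of_nonneg_right (by linarith [Real.exp_one_lt_d9]) (Real.exp_pos _).le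
      have h4 := abs_two_re_le c b r
      have h5 := abs_two_re_le (-Complex.I * b * c) b r
      have h6 : ‖-Complex.I * b * c‖ = |b| * ‖c‖ := by
        rw [norm_mul, norm_mul, norm_neg, Complex.norm_I, one_mul, Complex.norm_real,
          Real.norm_eq_abs]
      rw [h6] at h5
      rw [Real.norm_eq_abs]
      refine (abs_add_le _ _).trans ?_
      rw [abs_mul, abs_mul (gammaPow ω r)]
      have h7 := mul_le_mul h1 h4 (abs_nonneg _) (by positivity)
      have h8 := mul_le_mul h2 h5 (abs_nonneg _) (by positivity)
      have h9 := mul_le_mul_of_nonneg_left h3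
        (by positivity : 0 ≤ 96 * ‖c‖ * (1 + |b|) * Q)
      linarith)
    left_mem_uIcc right_mem_uIcc
  rw [Real.norm_eq_abs, Real.norm_eq_abs] at key
  have hE : expWeight X t * Real.exp (t / X) ≤ 1 := by
    refine (mul_le_mul_of_nonneg_right expWeight_le_exp (Real.exp_pos _).le).trans (le_of_eq ?_)
    rw [← Real.exp_add, neg_add_cancel, Real.exp_zero]
  have h1 := mul_le_mul_of_nonneg_left key (expWeight_nonneg hX0 (by linarith : 0 ≤ t))
  have h2 := mul_le_mul_of_nonneg_left hE
    (by positivity : 0 ≤ 288 * ‖c‖ * (1 + |b|) * Q * |t - s|)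
  simp only [D] at h1
  linarith

lemma waveTerm_mul_exp (c : ℂ) (b ω t : ℝ) (s : ℂ) :
    (waveTerm c b ω t : ℂ) * Complex.exp (-s * t) =
      c * ((gammaPow ω t : ℂ) * Complex.exp (-(s + Complex.I * b) * t)) +
      (starRingEnd ℂ) c * ((gammaPow ω t : ℂ) * Complex.exp (-(s - Complex.I * b) * t)) := by
  unfold waveTerm
  have h1 := Complex.add_conj (c * Complex.exp (-(Complex.I * (b : ℂ) * (t : ℂ))))
  have h2 : (starRingEnd ℂ) (Complex.exp (-(Complex.I * (b : ℂ) * (t : ℂ)))) =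
      Complex.exp (Complex.I * b * t) := by
    rw [← Complex.exp_conj]; congr 1; simp
  rw [map_mul, h2] at h1
  rw [Complex.ofReal_mul, ← h1]
  have h3 : Complex.exp (-(s + Complex.I * b) * t) =
      Complex.exp (-(Complex.I * (b : ℂ) * (t : ℂ))) * Complex.exp (-s * t) := by
    rw [← Complex.exp_add]; congr 1; ring
  have h4 : Complex.exp (-(s - Complex.I * b) * t) =
      Complex.exp (Complex.I * b * t) * Complex.exp (-s * t) := by
    rw [← Complex.exp_add]; congr 1; ring
  rw [h3, h4]; ring

lemma integrableOn_waveTerm_mul_exp (hω : -1 < ω) {s : ℂ} (hs : 0 < s.re) :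
    IntegrableOn (fun t : ℝ => (waveTerm c b ω t : ℂ) * Complex.exp (-s * t)) (Ioi 0) := by
  simp_rw [waveTerm_mul_exp]
  exact ((integrableOn_gammaPow_mul_exp hω (by simpa using hs)).const_mul c).add
    ((integrableOn_gammaPow_mul_exp hω (by simpa using hs)).const_mul _)

lemma laplace_waveTerm (hω : -1 < ω) {s : ℂ} (hs : 0 < s.re) :
    ∫ t in Ioi (0 : ℝ), (waveTerm c b ω t : ℂ) * Complex.exp (-s * t) =
      c / (s + Complex.I * b) ^ ((ω : ℂ) + 1) +
        (starRingEnd ℂ) c / (s - Complex.I * b) ^ ((ω : ℂ) + 1) := by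
  simp_rw [waveTerm_mul_exp]
  have h1 : 0 < (s + Complex.I * b).re := by simpa using hs
  have h2 : 0 < (s - Complex.I * b).re := by simpa using hs
  rw [integral_add ((integrableOn_gammaPow_mul_exp hω h1).const_mul c)
    ((integrableOn_gammaPow_mul_exp hω h2).const_mul _), integral_const_mul, integral_const_mul,
    laplace_gammaPow hω h1, laplace_gammaPow hω h2, mul_one_div, mul_one_div]

end waveTerm

section mainLog

variable {n : ℕ} {m : Fin (n + 1) → ℕ} (c : (k : Fin (n + 1)) → Fin (m k) → ℂ)
  (b : Fin (n + 1) → ℝ) (w : (k : Fin (n + 1)) → Fin (m k) → ℝ)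

/-- The main term on the logarithmic scale. -/
def mainLog (t : ℝ) : ℝ := ∑ k, ∑ l, waveTerm (c k l) (b k) (w k l) t

lemma mainTerm_eq (x : ℝ) : mainTerm c b w x = mainLog c b w (Real.log x) := rfl

/-- The constant in the bounds for the main term. -/
def mainConst : ℝ := ∑ k, ∑ l, 288 * ‖c k l‖ * (1 + |b k|)

lemma mainConst_nonneg : 0 ≤ mainConst c b :=
  Finset.sum_nonneg fun _ _ => Finset.sum_nonneg fun _ _ => by positivity

variable {c b w}

lemma le_maxExponent (k : Fin (n + 1)) (l : Fin (m k)) : w k l ≤ maxExponent w :=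
  le_ciSup (f := fun q : (Σ k, Fin (m k)) => w q.1 q.2) (Set.finite_range _).bddAbove ⟨k, l⟩

lemma expWeight_mul_abs_mainLog_le {X t : ℝ} (hX : 1 ≤ X) (hw : ∀ k l, -1 < w k l) (ht : 0 ≤ t) :
    expWeight X t * |mainLog c b w t| ≤ mainConst c b * X ^ (max (maxExponent w) 0) := by
  have h1 : |mainLog c b w t| ≤ ∑ k, ∑ l, |waveTerm (c k l) (b k) (w k l) t| :=
    (Finset.abs_sum_le_sum_abs _ _).trans
      (Finset.sum_le_sum fun _ _ => Finset.abs_sum_le_sum_abs _ _)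
  refine (mul_le_mul_of_nonneg_left h1 (expWeight_nonneg (by linarith) ht)).trans ?_
  simp only [mainConst, Finset.mul_sum, Finset.sum_mul]
  exact Finset.sum_le_sum fun k _ => Finset.sum_le_sum fun l _ =>
    expWeight_mul_abs_waveTerm_le hX (hw k l) (le_maxExponent k l) ht

lemma expWeight_mul_abs_mainLog_sub_le {X t s : ℝ} (hX : 1 ≤ X) (hw : ∀ k l, -1 < w k l)
    (ht : X / 4 ≤ t) (hs : X / 4 ≤ s) (hts : |t - s| ≤ X) :
    expWeight X t * |mainLog c b w t - mainLog c b w s| ≤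
      mainConst c b * X ^ (max (maxExponent w) 0) * |t - s| := by
  have h1 : |mainLog c b w t - mainLog c b w s| ≤
      ∑ k, ∑ l, |waveTerm (c k l) (b k) (w k l) t - waveTerm (c k l) (b k) (w k l) s| := by
    simp only [mainLog, ← Finset.sum_sub_distrib]
    exact (Finset.abs_sum_le_sum_abs _ _).trans
      (Finset.sum_le_sum fun _ _ => Finset.abs_sum_le_sum_abs _ _)
  refine (mul_le_mul_of_nonneg_left h1 (expWeight_nonneg (by linarith) (by linarith))).trans ?_
  simp only [mainConst, Finset.mul_sum, Finset.sum_mul]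
  exact Finset.sum_le_sum fun k _ => Finset.sum_le_sum fun l _ =>
    expWeight_mul_abs_waveTerm_sub_le hX (hw k l) (le_maxExponent k l) ht hs hts

lemma integrableOn_mainLog_mul_exp (hw : ∀ k l, -1 < w k l) {s : ℂ} (hs : 0 < s.re) :
    IntegrableOn (fun t : ℝ => (mainLog c b w t : ℂ) * Complex.exp (-s * t)) (Ioi 0) := by
  simp only [mainLog, Complex.ofReal_sum, Finset.sum_mul]
  exact integrable_finsetSum _ fun k _ => integrable_finsetSum _ fun l _ =>
    integrableOn_waveTerm_mul_exp (hw k l) hs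

/-- The Laplace transform of the main term is the singular part. -/
lemma laplace_mainLog (hw : ∀ k l, -1 < w k l) {s : ℂ} (hs : 0 < s.re) :
    ∫ t in Ioi (0 : ℝ), (mainLog c b w t : ℂ) * Complex.exp (-s * t) =
      singularPart c b w s := by
  simp only [mainLog, Complex.ofReal_sum, Finset.sum_mul, singularPart]
  rw [integral_finsetSum _ fun k _ => integrable_finsetSum _ fun l _ =>
    integrableOn_waveTerm_mul_exp (hw k l) hs]
  refine Finset.sum_congr rfl fun k _ => ?_
  rw [integral_finsetSum _ fun l _ => integrableOn_waveTerm_mul_exp (hw k l) hs]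
  exact Finset.sum_congr rfl fun l _ => laplace_waveTerm (hw k l) hs

end mainLog

/-! ### Controlled decrease on the logarithmic scale -/

/-- Iterating a bound for the decrease over steps of length at most `L`. -/
lemma decrease_of_step {h : ℝ → ℝ} {t₀ L δ : ℝ} (hL : 0 < L) (hδ : 0 ≤ δ)
    (hstep : ∀ t s, t₀ ≤ t → t ≤ s → s ≤ t + L → h t - h s ≤ δ) {t s : ℝ} (ht : t₀ ≤ t)
    (hts : t ≤ s) : h t - (1 + (s - t) / L) * δ ≤ h s := by
  have key : ∀ (n : ℕ) (s : ℝ), t ≤ s → s ≤ t + (n + 1) * L → h t - (n + 1) * δ ≤ h s := by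
    intro n
    induction n with
    | zero =>
      intro s h1 h2
      have := hstep t s ht h1 (by simpa using h2)
      simp; linarith
    | succ n ih =>
      intro s h1 h2
      push_cast at h2 ⊢
      rcases le_or_gt s (t + L) with h3 | h3
      · have := hstep t s ht h1 h3
        have : 0 ≤ ((n : ℝ) + 1) * δ := by positivity
        linarith
      · have h4 := ih (s - L) (by linarith) (by linarith)
        have h5 := hstep (s - L) s (by linarith) (by linarith) (by linarith)
        linarith
  have hq : 0 ≤ (s - t) / L := div_nonneg (by linarith) hL.le
  -- The floor of (s - t)/L plus one steps cover [t, s]; the extra step is the 1 in 1 + (s - t)/L.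
  have h1 := key ⌊(s - t) / L⌋₊ s hts (by
    have := (Nat.lt_floor_add_one ((s - t) / L)).le
    rw [div_le_iff₀ hL] at this
    linarith)
  have h2 := mul_le_mul_of_nonneg_right (Nat.floor_le hq) hδ
  linarith

section Decrease

variable {f : ℝ → ℝ} {N lam : ℝ}

lemma sub_le_of_nuBar_le (h : nuBar f 1 lam ≤ (N : EReal)) {x y : ℝ} (hx : 1 ≤ x) (hxy : x ≤ y)
    (hy : y ≤ lam * x) : f x - f y ≤ N := by
  have h1 : ((f x - f y : ℝ) : EReal) ≤ localDecrease f lam x :=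
    le_iSup₂ (f := fun y (_ : y ∈ Icc x (lam * x)) => ((f x - f y : ℝ) : EReal)) y ⟨hxy, hy⟩
  have h2 : localDecrease f lam x ≤ nuBar f 1 lam :=
    le_iSup₂ (f := fun x (_ : x ∈ Ici (1 : ℝ)) => localDecrease f lam x) x hx
  exact EReal.coe_le_coe_iff.1 ((h1.trans h2).trans h)

lemma nuBar_le_of_forall (h : ∀ x y, 1 ≤ x → x ≤ y → y ≤ lam * x → f x - f y ≤ N) :
    nuBar f 1 lam ≤ (N : EReal) :=
  iSup₂_le fun x hx => iSup₂_le fun y hy => EReal.coe_le_coe_iff.2 (h x y hx hy.1 hy.2)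

lemma nu_le_nuBar : nu f lam ≤ nuBar f 1 lam := by
  refine limsup_le_of_le (by isBoundedDefault) ?_
  filter_upwards [eventually_ge_atTop 1] with x hx
  exact le_iSup₂ (f := fun x (_ : x ∈ Ici (1 : ℝ)) => localDecrease f lam x) x hx

lemma nu_nonneg (hlam : 1 ≤ lam) : 0 ≤ nu f lam := by
  have h : limsup (fun _ : ℝ => (0 : EReal)) atTop ≤ nu f lam := by
    refine limsup_le_limsup ?_
    filter_upwards [eventually_ge_atTop 0] with x hx
    have h1 : ((f x - f x : ℝ) : EReal) ≤ localDecrease f lam x :=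
      le_iSup₂ (f := fun y (_ : y ∈ Icc x (lam * x)) => ((f x - f y : ℝ) : EReal)) x
        ⟨le_rfl, le_mul_of_one_le_left hx hlam⟩
    simpa using h1
  rwa [limsup_const] at h

lemma IsDecreaseRemainder.nonneg {Ψ : ℝ → ℝ} (h : IsDecreaseRemainder f 1 lam Ψ) {x : ℝ}
    (hx : 1 ≤ x) : 0 ≤ Ψ x := by
  refine le_of_tendsto h.tendsto_zero ?_
  filter_upwards [eventually_ge_atTop x] with y hy
  exact h.antitone hx (le_trans hx hy) hy

/-- ν lies between 0 (take y = x) and a finite bound for ν̄, so `toReal` loses nothing and `EReal`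
inequalities become real ones. -/
lemma coe_toReal_nu (hlam : 1 ≤ lam) (h : nuBar f 1 lam ≤ (N : EReal)) :
    (((nu f lam).toReal : ℝ) : EReal) = nu f lam := by
  refine EReal.coe_toReal ?_ ?_
  · exact ne_top_of_le_ne_top (EReal.coe_ne_top N) (nu_le_nuBar.trans h)
  · exact ne_bot_of_le_ne_bot EReal.zero_ne_bot (nu_nonneg hlam)

lemma IsDecreaseRemainder.sub_le {Ψ : ℝ → ℝ} (h : IsDecreaseRemainder f 1 lam Ψ)
    (hlam : 1 ≤ lam) (hN : nuBar f 1 lam ≤ (N : EReal)) {x y : ℝ} (hx : 1 ≤ x) (hxy : x ≤ y)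
    (hy : y ≤ lam * x) : f x - f y ≤ (nu f lam).toReal + Ψ x := by
  have h1 := h.lower x y hx hxy hy
  rw [← coe_toReal_nu hlam hN, ← EReal.coe_neg, ← EReal.coe_sub, EReal.coe_le_coe_iff] at h1
  linarith

/-- The upper condition on Ψ at x = 1; this bounds δ₀ in terms of ν̄. -/
lemma IsDecreaseRemainder.add_le {Ψ : ℝ → ℝ} (h : IsDecreaseRemainder f 1 lam Ψ)
    (hlam : 1 ≤ lam) (hN : nuBar f 1 lam ≤ (N : EReal)) :
    (nu f lam).toReal + Ψ 1 ≤ N := by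
  have h1 := (EReal.neg_le_neg_iff.2 hN).trans (h.upper 1 le_rfl)
  rw [← coe_toReal_nu hlam hN, ← EReal.coe_neg, ← EReal.coe_neg, ← EReal.coe_sub,
    EReal.coe_le_coe_iff] at h1
  linarith

end Decrease

section logDensity

variable {A : ℝ → ℝ} {N : ℝ}

lemma logDensity_log {x : ℝ} (hx : 0 < x) : logDensity A (Real.log x) = A x / x := by
  unfold logDensity; rw [Real.exp_log hx]

lemma logDensity_decrease (hN : nuBar (fun x => A x / x) 1 (Real.exp 1) ≤ (N : EReal))
    (hN0 : 0 ≤ N) {t s : ℝ} (ht : 0 ≤ t) (hts : t ≤ s) :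
    logDensity A t - (1 + (s - t)) * N ≤ logDensity A s := by
  have := decrease_of_step (h := logDensity A) (t₀ := 0) one_pos hN0 (fun t s h0 h1 h2 =>
    sub_le_of_nuBar_le hN (Real.one_le_exp h0) (Real.exp_monotone h1) (by
      rw [← Real.exp_add]; exact Real.exp_monotone (by linarith))) ht hts
  rwa [div_one] at this

lemma nonneg_of_nuBar_le {f : ℝ → ℝ} (hN : nuBar f 1 (Real.exp 1) ≤ (N : EReal)) : 0 ≤ N := by
  have := sub_le_of_nuBar_le hN le_rfl le_rfl (by
    rw [mul_one]; exact Real.one_le_exp zero_le_one)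
  linarith

/-- Iterating unit steps in log x transfers the bound from ratio e to ratio e^L, so the constant
depends on ν̄ at e alone and not on T. -/
lemma nuBar_exp_le (hN : nuBar (fun x => A x / x) 1 (Real.exp 1) ≤ (N : EReal)) (L : ℝ) :
    nuBar (fun x => A x / x) 1 (Real.exp L) ≤ ((N * (1 + L) : ℝ) : EReal) := by
  have hN0 := nonneg_of_nuBar_le hN
  refine nuBar_le_of_forall fun x y hx hxy hy => ?_
  have hx0 : 0 < x := by linarith
  have h1 := logDensity_decrease hN hN0 (Real.log_nonneg hx) (Real.log_le_log hx0 hxy)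
  rw [logDensity_log hx0, logDensity_log (by linarith)] at h1
  have h2 : Real.log y ≤ L + Real.log x := by
    rw [← Real.log_exp L, ← Real.log_mul (Real.exp_pos L).ne' hx0.ne']
    exact Real.log_le_log (by linarith) hy
  have h3 := mul_le_mul_of_nonneg_left (by linarith : Real.log y - Real.log x ≤ L) hN0
  linarith

lemma abs_one_le_supNormOn (hA : LocallyBoundedVariationOn A univ) :
    |A 1| ≤ supNormOn A (Icc 1 (Real.exp 1)) := by
  obtain ⟨P, Q, hP, hQ, rfl⟩ := hA.exists_monotoneOn_sub_monotoneOn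
  rw [monotoneOn_univ] at hP hQ
  refine le_csSup ⟨|P 1| + |P (Real.exp 1)| + (|Q 1| + |Q (Real.exp 1)|), ?_⟩
    ⟨1, ⟨le_rfl, Real.one_le_exp zero_le_one⟩, rfl⟩
  rintro _ ⟨x, ⟨hx1, hx2⟩, rfl⟩
  have h3 : ∀ R : ℝ → ℝ, Monotone R → |R x| ≤ |R 1| + |R (Real.exp 1)| := by
    intro R hR
    have h4 := hR hx1
    have h5 := hR hx2
    rw [abs_le]
    constructor
    · linarith [neg_abs_le (R 1), abs_nonneg (R (Real.exp 1))]
    · linarith [le_abs_self (R (Real.exp 1)), abs_nonneg (R 1)]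
  have := abs_sub (P x) (Q x)
  simp only [Pi.sub_apply]
  linarith [h3 P hP, h3 Q hQ]

end logDensity

/-! ### The weighted difference and the function η -/

section Transform

variable {n : ℕ} {m : Fin (n + 1) → ℕ} {c : (k : Fin (n + 1)) → Fin (m k) → ℂ}
  {b : Fin (n + 1) → ℝ} {w : (k : Fin (n + 1)) → Fin (m k) → ℝ} {A : ℝ → ℝ}

/-- The weighted difference of `A(x) / x` and the main term on the logarithmic scale. -/
def weightedDiff (c : (k : Fin (n + 1)) → Fin (m k) → ℂ) (b : Fin (n + 1) → ℝ)
    (w : (k : Fin (n + 1)) → Fin (m k) → ℝ) (A : ℝ → ℝ) (X : ℝ) : ℝ → ℝ :=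
  (Ioi 0).indicator fun t => expWeight X t * (logDensity A t - mainLog c b w t)

/-- `f` grows more slowly than every exponential function on `[0, ∞)`. -/
def SubexpGrowth (f : ℝ → ℝ) : Prop :=
  ∀ ε : ℝ, 0 < ε → ∃ C, 0 ≤ C ∧ ∀ t, 0 ≤ t → |f t| ≤ C * Real.exp (ε * t)

lemma integrableOn_diff_mul_exp (hA : LocallyBoundedVariationOn A univ)
    (hw : ∀ k l, -1 < w k l) (hgrow : SubexpGrowth (logDensity A)) {s : ℂ} (hs : 0 < s.re) :
    IntegrableOn (fun t : ℝ => ((logDensity A t - mainLog c b w t : ℝ) : ℂ) *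
      Complex.exp (-s * t)) (Ioi 0) := by
  have h := (integrableOn_mul_exp_of_growth (measurable_logDensity hA) hgrow hs).sub
    (integrableOn_mainLog_mul_exp (c := c) (b := b) hw hs)
  refine h.congr_fun (fun t _ => ?_) measurableSet_Ioi
  simp only [Pi.sub_apply]; push_cast; ring

lemma regTransform_eq_laplace (hA : LocallyBoundedVariationOn A univ)
    (hconv : ∀ s : ℂ, 1 < s.re → MellinStieltjesConverges A s)
    (hw : ∀ k l, -1 < w k l) (hgrow : SubexpGrowth (logDensity A)) {s : ℂ} (hs : 0 < s.re) :
    regTransform c b w A s = ∫ t in Ioi (0 : ℝ),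
      ((logDensity A t - mainLog c b w t : ℝ) : ℂ) * Complex.exp (-s * t) := by
  unfold regTransform
  rw [mellinStieltjes_eq_laplace hA hconv hgrow hs, ← laplace_mainLog hw hs, ← integral_sub
    (integrableOn_mul_exp_of_growth (measurable_logDensity hA) hgrow hs)
    (integrableOn_mainLog_mul_exp (c := c) (b := b) hw hs)]
  refine setIntegral_congr_fun measurableSet_Ioi fun t _ => ?_
  push_cast; ring

lemma expWeight_mul_exp (X t φ : ℝ) :
    Complex.exp (-(Complex.I * φ * t)) * (expWeight X t : ℂ) =
      Complex.exp (-(((1 / X : ℝ) : ℂ) + Complex.I * φ) * t) -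
      Complex.exp (-(2 * ((1 / X : ℝ) : ℂ) + Complex.I * φ) * t) := by
  unfold expWeight
  push_cast
  rw [mul_sub, ← Complex.exp_add, ← Complex.exp_add]
  congr 2 <;> ring

lemma weightedDiff_mul_exp (X φ t : ℝ) (f : ℝ) :
    Complex.exp (-(Complex.I * φ * t)) * ((expWeight X t * f : ℝ) : ℂ) =
      (f : ℂ) * Complex.exp (-(((1 / X : ℝ) : ℂ) + Complex.I * φ) * t) -
      (f : ℂ) * Complex.exp (-(2 * ((1 / X : ℝ) : ℂ) + Complex.I * φ) * t) := by
  rw [Complex.ofReal_mul, ← mul_assoc, expWeight_mul_exp]; ring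

lemma re_one_div_add {X : ℝ} (hX : 0 < X) (φ : ℝ) :
    0 < (((1 / X : ℝ) : ℂ) + Complex.I * φ).re := by simpa using hX

lemma re_two_mul_one_div_add {X : ℝ} (hX : 0 < X) (φ : ℝ) :
    0 < (2 * ((1 / X : ℝ) : ℂ) + Complex.I * φ).re := by simpa using hX

lemma integrable_weightedDiff (hA : LocallyBoundedVariationOn A univ)
    (hw : ∀ k l, -1 < w k l) (hgrow : SubexpGrowth (logDensity A)) {X : ℝ} (hX : 0 < X) :
    Integrable (weightedDiff c b w A X) := by
  unfold weightedDiff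
  rw [integrable_indicator_iff measurableSet_Ioi]
  have h := (integrableOn_diff_mul_exp (c := c) (b := b) hA hw hgrow (re_one_div_add hX 0)).sub
    (integrableOn_diff_mul_exp (c := c) (b := b) hA hw hgrow (re_two_mul_one_div_add hX 0))
  have h2 : IntegrableOn (fun t : ℝ =>
      ((expWeight X t * (logDensity A t - mainLog c b w t) : ℝ) : ℂ)) (Ioi 0) := by
    refine h.congr_fun (fun t _ => ?_) measurableSet_Ioi
    simp only [Pi.sub_apply]
    rw [← weightedDiff_mul_exp]
    simp
  exact h2.re

/-- The two exponentials of the weight shift the Laplace variable to real parts 1/X and 2/X, so the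
difference of G defining η appears with σ = 1/X. -/
lemma fourierInt_weightedDiff (hA : LocallyBoundedVariationOn A univ)
    (hconv : ∀ s : ℂ, 1 < s.re → MellinStieltjesConverges A s)
    (hw : ∀ k l, -1 < w k l) (hgrow : SubexpGrowth (logDensity A)) {X : ℝ} (hX : 0 < X) (φ : ℝ) :
    fourierInt (fun t => (weightedDiff c b w A X t : ℂ)) φ =
      regTransform c b w A (((1 / X : ℝ) : ℂ) + Complex.I * φ) -
        regTransform c b w A (2 * ((1 / X : ℝ) : ℂ) + Complex.I * φ) := by
  rw [regTransform_eq_laplace hA hconv hw hgrow (re_one_div_add hX φ),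
    regTransform_eq_laplace hA hconv hw hgrow (re_two_mul_one_div_add hX φ), ← integral_sub
    (integrableOn_diff_mul_exp hA hw hgrow (re_one_div_add hX φ))
    (integrableOn_diff_mul_exp hA hw hgrow (re_two_mul_one_div_add hX φ)),
    ← integral_indicator measurableSet_Ioi]
  unfold fourierInt weightedDiff
  refine integral_congr_ae ?_
  filter_upwards with t
  by_cases ht : t ∈ Ioi (0 : ℝ)
  · rw [indicator_of_mem ht, indicator_of_mem ht, weightedDiff_mul_exp]
  · rw [indicator_of_notMem ht, indicator_of_notMem ht]; simp

lemma fourierInt_comp_div (u : ℝ → ℂ) {T : ℝ} (hT : 0 < T) (φ : ℝ) :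
    fourierInt (fun z => u (z / T)) φ = T * fourierInt u (T * φ) := by
  unfold fourierInt
  have h := Measure.integral_comp_div
    (fun t : ℝ => Complex.exp (-(Complex.I * (T * φ : ℝ) * t)) * u t) T
  rw [abs_of_pos hT, Complex.real_smul] at h
  rw [← h]
  refine integral_congr_ae ?_
  filter_upwards with z
  congr 3
  have hT' : (T : ℂ) ≠ 0 := by exact_mod_cast hT.ne'
  push_cast
  field_simp

/-- Dilation by T stretches [-1, 1] to [-T, T]; the factor T of the transform is the Jacobian. -/
lemma integral_norm_fourierInt_scaled (hA : LocallyBoundedVariationOn A univ)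
    (hconv : ∀ s : ℂ, 1 < s.re → MellinStieltjesConverges A s)
    (hw : ∀ k l, -1 < w k l) (hgrow : SubexpGrowth (logDensity A)) {X T : ℝ} (hX : 0 < X)
    (hT : 0 < T) :
    ∫ φ in (-1 : ℝ)..1, ‖fourierInt (fun z => (weightedDiff c b w A X (z / T) : ℂ)) φ‖ =
      eta c b w A (1 / X) T := by
  have h1 : ∀ φ : ℝ, ‖fourierInt (fun z => (weightedDiff c b w A X (z / T) : ℂ)) φ‖ =
      T * ‖regTransform c b w A (2 * ((1 / X : ℝ) : ℂ) + Complex.I * ((T * φ : ℝ) : ℂ)) -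
        regTransform c b w A (((1 / X : ℝ) : ℂ) + Complex.I * ((T * φ : ℝ) : ℂ))‖ := by
    intro φ
    rw [fourierInt_comp_div (fun t => (weightedDiff c b w A X t : ℂ)) hT,
      fourierInt_weightedDiff hA hconv hw hgrow hX, norm_mul, Complex.norm_real,
      Real.norm_of_nonneg hT.le, norm_sub_rev]
  simp_rw [h1]
  rw [intervalIntegral.integral_const_mul]
  have h2 := intervalIntegral.mul_integral_comp_mul_left (a := -1) (b := 1)
    (f := fun τ : ℝ => ‖regTransform c b w A (2 * ((1 / X : ℝ) : ℂ) + Complex.I * (τ : ℂ)) -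
        regTransform c b w A (((1 / X : ℝ) : ℂ) + Complex.I * (τ : ℂ))‖) (c := T)
  rw [h2, mul_one, mul_neg_one]
  rfl

lemma eta_nonneg (σ : ℝ) {T : ℝ} (hT : 0 ≤ T) : 0 ≤ eta c b w A σ T :=
  intervalIntegral.integral_nonneg (by linarith) fun _ _ => norm_nonneg _

/-- Growth with ε = 1/X is exactly cancelled by the weight. The bound P is not effective and never
enters the final constant. -/
lemma exists_abs_weightedDiff_le (hw : ∀ k l, -1 < w k l) (hgrow : SubexpGrowth (logDensity A))
    {X : ℝ} (hX : 1 ≤ X) : ∃ P, ∀ t, |weightedDiff c b w A X t| ≤ P := by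
  have hX0 : 0 < X := by linarith
  obtain ⟨C, hC0, hC⟩ := hgrow (1 / X) (by positivity)
  have hB := mainConst_nonneg c b
  refine ⟨C + mainConst c b * X ^ (max (maxExponent w) 0), fun t => ?_⟩
  unfold weightedDiff
  by_cases ht : t ∈ Ioi (0 : ℝ)
  · have ht0 : 0 ≤ t := le_of_lt ht
    have hE := expWeight_nonneg hX0 ht0
    rw [indicator_of_mem ht, abs_mul, abs_of_nonneg hE]
    have h1 := mul_le_mul_of_nonneg_left (abs_sub (logDensity A t) (mainLog c b w t)) hE
    have h2 := expWeight_mul_abs_mainLog_le (c := c) (b := b) hX hw ht0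
    have h3 : expWeight X t * |logDensity A t| ≤ C := by
      have h4 := mul_le_mul (expWeight_le_exp (X := X) (t := t)) (hC t ht0) (abs_nonneg _)
        (Real.exp_pos _).le
      refine h4.trans (le_of_eq ?_)
      rw [mul_left_comm, ← Real.exp_add]
      rw [show -(t / X) + 1 / X * t = 0 by ring, Real.exp_zero, mul_one]
    linarith
  · rw [indicator_of_notMem ht, abs_zero]; positivity

end Transform

/-- With X = log x, the far decrease δ₁ uses Ψ at e^{X/2} = √x, since Ψ is nonincreasing and t ≥
X/2; δ₀ uses Ψ(1). -/
lemma tauberianData {n : ℕ} {m : Fin (n + 1) → ℕ} (c : (k : Fin (n + 1)) → Fin (m k) → ℂ)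
    (b : Fin (n + 1) → ℝ) {w : (k : Fin (n + 1)) → Fin (m k) → ℝ} (hw : ∀ k l, -1 < w k l)
    {A : ℝ → ℝ} (hA : LocallyBoundedVariationOn A univ)
    (hconv : ∀ s : ℂ, 1 < s.re → MellinStieltjesConverges A s) {T X N : ℝ} (hT : 0 < T)
    (hX : 1 ≤ X) (hTX : 2 ≤ T * X) (hN : nuBar (fun x => A x / x) 1 (Real.exp 1) ≤ (N : EReal))
    {Ψ : ℝ → ℝ} (hΨ : IsDecreaseRemainder (fun x => A x / x) 1 (Real.exp (1 / T)) Ψ) :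
    TauberianData N (supNormOn A (Icc 1 (Real.exp 1))) (mainConst c b) X T
      (X ^ (max (maxExponent w) 0)) (eta c b w A (1 / X) T)
      ((nu (fun x => A x / x) (Real.exp (1 / T))).toReal + Ψ 1)
      ((nu (fun x => A x / x) (Real.exp (1 / T))).toReal + Ψ (Real.exp (X / 2)))
      (logDensity A) (mainLog c b w) (weightedDiff c b w A X) := by
  have hX0 : 0 < X := by linarith
  have hN0 := nonneg_of_nuBar_le hN
  have hlam : 1 ≤ Real.exp (1 / T) := Real.one_le_exp (by positivity)
  have hNT := nuBar_exp_le hN (1 / T)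
  have hnu : 0 ≤ (nu (fun x => A x / x) (Real.exp (1 / T))).toReal :=
    EReal.toReal_nonneg (nu_nonneg hlam)
  have hX2 : 1 ≤ Real.exp (X / 2) := Real.one_le_exp (by linarith)
  have hzero : -supNormOn A (Icc 1 (Real.exp 1)) ≤ logDensity A 0 := by
    have h1 := abs_one_le_supNormOn hA
    simp only [logDensity, Real.exp_zero, div_one]
    linarith [neg_abs_le (A 1)]
  have hM0 : 0 ≤ supNormOn A (Icc 1 (Real.exp 1)) :=
    (abs_nonneg _).trans (abs_one_le_supNormOn hA)
  have hlow : ∀ t, 0 ≤ t →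
      -supNormOn A (Icc 1 (Real.exp 1)) - N * (1 + t) ≤ logDensity A t := by
    intro t ht
    have := logDensity_decrease hN hN0 le_rfl ht
    rw [sub_zero] at this
    linarith
  have hgrow : SubexpGrowth (logDensity A) := fun ε hε =>
    exists_abs_logDensity_le_exp hA hconv hM0 hN0 hlow hε
  have hstep : ∀ t₀, 0 ≤ t₀ → ∀ t s, t₀ ≤ t → t ≤ s → s ≤ t + 1 / T →
      logDensity A t - logDensity A s ≤
        (nu (fun x => A x / x) (Real.exp (1 / T))).toReal + Ψ (Real.exp t₀) := by
    intro t₀ ht₀ t s h0 h1 h2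
    have ht1 : 1 ≤ Real.exp t := Real.one_le_exp (ht₀.trans h0)
    have h3 := hΨ.sub_le hlam hNT ht1 (Real.exp_monotone h1)
      (by rw [← Real.exp_add]; exact Real.exp_monotone (by linarith))
    have h4 := hΨ.antitone (Real.one_le_exp ht₀) ht1 (Real.exp_monotone h0)
    exact h3.trans (by linarith)
  have hdec : ∀ t₀, 0 ≤ t₀ → ∀ t s, t₀ ≤ t → t ≤ s → logDensity A t - (1 + T * (s - t)) *
      ((nu (fun x => A x / x) (Real.exp (1 / T))).toReal + Ψ (Real.exp t₀)) ≤
        logDensity A s := by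
    intro t₀ ht₀ t s h0 h1
    have h2 := decrease_of_step (by positivity : 0 < 1 / T)
      (add_nonneg hnu (hΨ.nonneg (Real.one_le_exp ht₀))) (hstep t₀ ht₀) h0 h1
    have e : (s - t) / (1 / T) = T * (s - t) := by field_simp
    rwa [e] at h2
  have hint := integrable_weightedDiff (c := c) (b := b) hA hw hgrow hX0
  refine
    { one_le_X := hX
      T_pos := hT
      two_le := hTX
      one_le_Q := Real.one_le_rpow hX (le_max_right _ _)
      eta_nonneg := eta_nonneg _ hT.le
      delta₀_nonneg := add_nonneg hnu (hΨ.nonneg le_rfl)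
      delta₁_nonneg := add_nonneg hnu (hΨ.nonneg hX2)
      delta₀_le := hΨ.add_le hlam hNT
      decrease := fun t s h0 h1 => by simpa only [Real.exp_zero] using hdec 0 le_rfl t s h0 h1
      decrease_far := hdec (X / 2) (by linarith)
      zero_le := hzero
      lower := hlow
      main_le := fun t ht => expWeight_mul_abs_mainLog_le hX hw ht
      main_osc := fun t s ht hs hts => expWeight_mul_abs_mainLog_sub_le hX hw ht hs hts
      u_of_nonneg := fun t ht => ?_
      u_of_neg := fun t ht => indicator_of_notMem (by simpa using ht.le) _
      integrable := hint
      bounded := exists_abs_weightedDiff_le hw hgrow hX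
      means_le := fun y => ?_ }
  · rcases ht.eq_or_lt with rfl | ht
    · rw [expWeight_zero, zero_mul]
      exact indicator_of_notMem (by simp) _
    · exact indicator_of_mem (by exact ht) _
  · rw [← integral_norm_fourierInt_scaled hA hconv hw hgrow hX0 hT]
    exact abs_integral_jacksonKernel_mul_le (hint.comp_div hT.ne') y

end WienerIkehara

end

/-! ### Return to the original variable -/

open WienerIkehara in
theorem mainTheorem2
    (n : ℕ) (m : Fin (n + 1) → ℕ) (hm : ∀ k, 0 < m k)
    (c : (k : Fin (n + 1)) → Fin (m k) → ℂ)
    (b : Fin (n + 1) → ℝ) (hb_zero : b 0 = 0) (hb_pos : ∀ k, k ≠ 0 → 0 < b k)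
    -- the quantities on which the implicit constant may depend, besides `c` and `b`:
    -- `ν̄(A(x)/x; e)`, `‖A‖_{[1,e]}`, `𝒜(2)` and the constant in the bound for `η`
    (N M : ℝ) (a₂ : ℂ) (K : ℝ) :
    ∃ C : ℝ, 0 < C ∧
      ∀ (w : (k : Fin (n + 1)) → Fin (m k) → ℝ) (_ : ∀ k l, -1 < w k l)
        (A : ℝ → ℝ) (_ : LocallyBoundedVariationOn A Set.univ)
        (_ : ∀ x, x < 1 → A x = 0)
        (_ : ∀ s : ℂ, 1 < s.re → MellinStieltjesConverges A s)
        (_ : IsSlowlyDecreasing (fun x => A x / x))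
        (T : ℝ) (_ : 0 < T)
        (_ : ∀ σ : ℝ, 0 < σ → σ < 1 →
          eta c b w A σ T ≤ K * σ ^ (-(max (maxExponent w) 0)))
        (_ : nuBar (fun x => A x / x) 1 (Real.exp 1) = (N : EReal))
        (_ : supNormOn A (Set.Icc 1 (Real.exp 1)) = M)
        (_ : mellinStieltjes A 2 = a₂)
        (Ψ : ℝ → ℝ) (_ : IsDecreaseRemainder (fun x => A x / x) 1 (Real.exp (1 / T)) Ψ)
        (x : ℝ) (_ : max (Real.exp 1) (max (Real.exp (17 / T)) (Real.exp (17 / Real.sqrt T))) ≤ x),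
        |A x - x * mainTerm c b w x| ≤ C * (x * errorRho c b w A Ψ T x) := by
  -- The constant is fixed before A is given, when N and M are arbitrary reals; absolute values
  -- supply the signs and are removed once A is present.
  obtain ⟨C, hC, hmain⟩ := exists_tauberian_constant |N| |M| (mainConst c b) (abs_nonneg _)
    (abs_nonneg _) (mainConst_nonneg c b)
  refine ⟨C, hC, fun w hw A hA _ hconv _ T hT _ hN hM _ Ψ hΨ x hx => ?_⟩
  have hx1 : Real.exp 1 ≤ x := (le_max_left _ _).trans hx
  have hx2 : Real.exp (17 / T) ≤ x := ((le_max_left _ _).trans (le_max_right _ _)).trans hx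
  have hx0 : 0 < x := (Real.exp_pos 1).trans_le hx1
  set X := Real.log x with hXdef
  have hX : 1 ≤ X := (Real.le_log_iff_exp_le hx0).2 hx1
  have hTX : 2 ≤ T * X := by
    have h := (Real.le_log_iff_exp_le hx0).2 hx2
    rw [div_le_iff₀ hT] at h
    linarith
  have d := tauberianData c b hw hA hconv hT hX hTX hN.le hΨ
  rw [hM] at d
  have hM0 : |M| = M := abs_of_nonneg (by
    rw [← hM]; exact (abs_nonneg _).trans (abs_one_le_supNormOn hA))
  have hN0 : |N| = N := abs_of_nonneg (nonneg_of_nuBar_le hN.le)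
  rw [← hM0, ← hN0] at d
  have key := hmain _ _ _ _ _ _ _ _ _ d
  have hsqrt : Real.exp (X / 2) = Real.sqrt x := by
    rw [hXdef, ← Real.log_sqrt hx0.le, Real.exp_log (Real.sqrt_pos.2 hx0)]
  rw [hsqrt] at key d
  have hlhs : |A x - x * mainTerm c b w x| = x * |logDensity A X - mainLog c b w X| := by
    rw [mainTerm_eq, ← hXdef, hXdef, logDensity_log hx0, ← abs_of_pos hx0, ← abs_mul,
      abs_of_pos hx0]
    congr 1
    field_simp
  rw [hlhs, mul_left_comm]
  refine mul_le_mul_of_nonneg_left (key.trans (mul_le_mul_of_nonneg_left ?_ hC.le)) hx0.le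
  have hx1' : 1 ≤ x := (Real.one_le_exp zero_le_one).trans hx1
  have hsx : 1 ≤ Real.sqrt x := Real.one_le_sqrt.2 hx1'
  have hΨ0 := hΨ.nonneg hsx
  -- Ψ(√x) ≤ Ψ(1), so Ψ(√x) is at most the geometric mean occurring in ρ_T.
  have hΨ1 : Ψ (Real.sqrt x) ≤ Real.sqrt (Ψ 1 * Ψ (Real.sqrt x)) := by
    refine Real.le_sqrt_of_sq_le ?_
    rw [sq]
    exact mul_le_mul_of_nonneg_right (hΨ.antitone (Set.mem_Ici.2 le_rfl) hsx hsx) hΨ0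
  have hη := d.eta_nonneg
  have hR : (nu (fun t => A t / t) (Real.exp (1 / T))).toReal + eta c b w A (1 / X) T +
      X ^ (max (maxExponent w) 0) / T ≤ errorR c b w A T x := by
    unfold errorR
    rw [← hXdef]
    have h1 : 0 ≤ 1 / T * eta c b w A (1 / X) T := by positivity
    have h2 : 0 ≤ Real.log X / T := div_nonneg (Real.log_nonneg hX) hT.le
    have h3 : 0 ≤ 1 / (T ^ (minExponent w + 1) * X) := by positivity
    have h4 : 0 ≤ 1 / (T ^ (maxExponent w + 1) * X) := by positivity
    rw [add_div]
    linarith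
  have hlast := Real.sqrt_nonneg (Ψ 1 * errorR c b w A T x)
  unfold errorRho
  linarith
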